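/- Let $\Bbbk$ be an algebraically closed field with $\operatorname{char}\Bbbk\neq 2$, and let $X,Y\subset\mathbb{A}^n$ be nonempty affine varieties (Zariski closed subsets, not necessarily irreducible). The following two conditions are equivalent: (a) the projective closures $\overline X,\overline Y\subset\mathbb{P}^n$ are contained in complementary linear subspaces of $\mathbb{P}^n$, i.e. in linear subspaces $L\supseteq\overline X$ and $M\supseteq\overline Y$ that are disjoint and together span $\mathbb{P}^n$; (b) $X$ and $Y$ are contained in disjoint affine subspaces of $\mathbb{A}^n$ that have no direction in common, i.e. whose direction vector spaces intersect only in $0$. If these conditions hold, then for generic $\alpha\in\Bbbk^\times$, i.e. for all but finitely many $\alpha$, $$\deg(\alpha X+Y)=\deg(X)\cdot\deg(Y).$$ Here $\alpha X=\{\alpha x : x\in X\}$, the Minkowski sum $X'+Y$ is the Zariski closure in $\mathbb{A}^n$ of $\{x+y : x\in X',\ y\in Y\}$, and the degree of an affine variety $Z\subset\mathbb{A}^n$ of dimension $d$ is the number of points in which $Z$ meets a general affine linear subspace of dimension $n-d$; in particular these degrees are well defined. -/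

import Mathlib

open scoped Pointwise LinearAlgebra.Projectivization

namespace MinkowskiDegree

variable {𝕜 : Type*} [Field 𝕜] {n : ℕ}

/-- Affine varieties (not necessarily irreducible): Zariski closed subsets of `𝔸ⁿ = 𝕜ⁿ`. -/
def IsAffineVariety (X : Set (Fin n → 𝕜)) : Prop :=
  ∃ I : Ideal (MvPolynomial (Fin n) 𝕜), X = MvPolynomial.zeroLocus 𝕜 I

/-- The Zariski closure of a subset of `𝔸ⁿ`. -/
def zariskiClosure (S : Set (Fin n → 𝕜)) : Set (Fin n → 𝕜) :=
  MvPolynomial.zeroLocus 𝕜 (MvPolynomial.vanishingIdeal 𝕜 S)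

/-- The Minkowski sum: the Zariski closure of the setwise sum `{x + y | x ∈ X, y ∈ Y}`. -/
def minkowskiSum (X Y : Set (Fin n → 𝕜)) : Set (Fin n → 𝕜) :=
  zariskiClosure (X + Y)

/-- The dimension of `X ⊆ 𝔸ⁿ`: the Krull dimension of its coordinate ring `𝕜[x₁,…,xₙ] / I(X)`. -/
noncomputable def dimension (X : Set (Fin n → 𝕜)) : WithBot ℕ∞ :=
  ringKrullDim (MvPolynomial (Fin n) 𝕜 ⧸ MvPolynomial.vanishingIdeal 𝕜 X)

/-- The affine linear subspace `{x | c i 0 + ∑ j, c i (j + 1) * x j = 0 for all i}` of `𝔸ⁿ` cut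
out by the `d` affine linear equations with coefficients `c`. -/
def linearSection (d : ℕ) (c : Fin d × Fin (n + 1) → 𝕜) : Set (Fin n → 𝕜) :=
  {x | ∀ i, c (i, 0) + ∑ j, c (i, Fin.succ j) * x j = 0}

/-- `X` has degree `δ`: with `d = dim X`, a general linear subspace of dimension `n - d` meets `X`
in exactly `δ` points. Linear subspaces of dimension `n - d` are those cut out by `d` independent
equations; "general" means that the vector of coefficients of the equations lies in a nonempty
Zariski open set, which may be taken to be the nonvanishing locus of a nonzero polynomial
(dependent or inconsistent equations lie in a proper closed subset, as `d ≤ n`). -/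
def HasDegree (X : Set (Fin n → 𝕜)) (δ : ℕ) : Prop :=
  ∃ d : ℕ, dimension X = d ∧ ∃ P : MvPolynomial (Fin d × Fin (n + 1)) 𝕜, P ≠ 0 ∧
    ∀ c : Fin d × Fin (n + 1) → 𝕜, MvPolynomial.eval c P ≠ 0 →
      (X ∩ linearSection d c).encard = δ

/-- The degree is unique, so one may speak of the degree of `X`. -/
theorem HasDegree.unique [Infinite 𝕜] {X : Set (Fin n → 𝕜)} {δ ε : ℕ}
    (h : HasDegree X δ) (h' : HasDegree X ε) : δ = ε := by
  obtain ⟨d, hd, P, hP, H⟩ := h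
  obtain ⟨e, he, Q, hQ, H'⟩ := h'
  obtain rfl : d = e := by
    rw [hd] at he
    exact_mod_cast he
  obtain ⟨c, hc⟩ : ∃ c, MvPolynomial.eval c (P * Q) ≠ 0 := by
    by_contra! hcon
    exact mul_ne_zero hP hQ (MvPolynomial.funext fun c => by simpa using hcon c)
  rw [map_mul] at hc
  have h1 := H c (left_ne_zero_of_mul hc)
  rw [H' c (right_ne_zero_of_mul hc)] at h1
  exact_mod_cast h1.symm

/-- The projective closure in `ℙⁿ` of `X ⊆ 𝔸ⁿ`, where `𝔸ⁿ ⊆ ℙⁿ` through `x ↦ [1 : x]`: the common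
zeros of all homogeneous polynomials that vanish on `X`. (For homogeneous `F`, whether `F` vanishes
at `p` does not depend on the representative.) -/
def projectiveClosure (X : Set (Fin n → 𝕜)) : Set (ℙ 𝕜 (Fin (n + 1) → 𝕜)) :=
  {p | ∀ (m : ℕ) (F : MvPolynomial (Fin (n + 1)) 𝕜), F.IsHomogeneous m →
    (∀ x ∈ X, MvPolynomial.eval (Fin.cons 1 x : Fin (n + 1) → 𝕜) F = 0) →
      MvPolynomial.eval p.rep F = 0}

/-- The projective closures of `X` and `Y` lie in complementary linear subspaces of `ℙⁿ`, that is,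
disjoint ones that together span `ℙⁿ`. -/
def InComplementarySubspaces (X Y : Set (Fin n → 𝕜)) : Prop :=
  ∃ L M : Projectivization.Subspace 𝕜 (Fin (n + 1) → 𝕜), IsCompl L M ∧
    projectiveClosure X ⊆ (L : Set (ℙ 𝕜 (Fin (n + 1) → 𝕜))) ∧
    projectiveClosure Y ⊆ (M : Set (ℙ 𝕜 (Fin (n + 1) → 𝕜)))

/-- `X` and `Y` lie in disjoint affine subspaces with no common direction. -/
def InDisjointNonparallelSubspaces (X Y : Set (Fin n → 𝕜)) : Prop :=
  ∃ A B : AffineSubspace 𝕜 (Fin n → 𝕜),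
    Disjoint (A : Set (Fin n → 𝕜)) (B : Set (Fin n → 𝕜)) ∧
    Disjoint A.direction B.direction ∧
    X ⊆ (A : Set (Fin n → 𝕜)) ∧ Y ⊆ (B : Set (Fin n → 𝕜))

end MinkowskiDegree

/-! Filter the coordinate ring of `Z` by the powers of the space `V` of restrictions of affine
linear functions. The degree can be read off from this filtration. Choose Noether parameters `ℓ`
inside `V` such that finitely many elements generate the ring over `k[ℓ]`, with coefficients of
degree at most `s` sufficing for `V ^ s`, and let `e` be a maximal family of generators independent
over `k[ℓ]`. Then the size of `e` is the degree of the Zariski closure of `Z`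
(`NoetherFrame.hasDegree`).

If two direction spaces meet only in `0`, a linear form can be prescribed on both independently. So
the affine linear functions of `α x + y` are exactly the sums of affine linear functions of `x` and
of `y` (`affineSpan_smul_add`). Inside the functions on `X × Y`, the coordinate rings of `α X + Y`
and of `X × Y` are therefore the same filtered algebra, for every `α ≠ 0`. Frames multiply
(`NoetherFrame.prod`), hence so do degrees, and no `α ≠ 0` is exceptional.

To see that `e` counts points, project by `d` linear forms with indeterminate coefficients `c`. The
family `e` stays independent over these forms, because it is so after `c` is specialized to the
coefficients of `ℓ`. No independent family is larger, because it would make the dimension of `V ^ s`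
grow too fast (`NoetherFrame.finrank_pow_le`, `le_of_growth`). So the generic fibre has rank `|e|`.
It is unramified in every characteristic: `k` is perfect, and `d` generic combinations of the `x j`
determine a space of differentials of dimension at most `d` (`derivation_eq_zero_of_generic`). A
general fibre is then a product of `|e|` copies of `k`.

The equivalence of the two conditions is the passage between linear subspaces of `k ^ (n + 1)` and
their slices at first coordinate `1`. -/

namespace MinkowskiDegree

open MvPolynomial

/-! ### The filtration by degree. -/

section AffineSpan

variable {k A : Type*} [CommRing k] [CommRing A] [Algebra k A]

/-- The space of affine linear combinations `a₀ + ∑ aⱼ xⱼ` of a family `x` in a `k`-algebra. -/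
def affineSpan (k : Type*) {A : Type*} [CommRing k] [CommRing A] [Algebra k A] {ι : Type*}
    (x : ι → A) : Submodule k A :=
  Submodule.span k (insert 1 (Set.range x))

lemma one_mem_affineSpan {ι : Type*} (x : ι → A) : (1 : A) ∈ affineSpan k x :=
  Submodule.subset_span (Set.mem_insert _ _)

lemma mem_affineSpan {ι : Type*} (x : ι → A) (i : ι) : x i ∈ affineSpan k x :=
  Submodule.subset_span (Set.mem_insert_of_mem _ ⟨i, rfl⟩)

lemma one_le_affineSpan {ι : Type*} (x : ι → A) : 1 ≤ affineSpan k x :=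
  Submodule.one_le.2 (one_mem_affineSpan x)

lemma affineSpan_le {ι : Type*} {x : ι → A} {V : Submodule k A} (h1 : (1 : A) ∈ V)
    (hx : ∀ i, x i ∈ V) : affineSpan k x ≤ V := by
  refine Submodule.span_le.2 (Set.insert_subset h1 ?_)
  rintro _ ⟨i, rfl⟩
  exact hx i

lemma affineSpan_fg {ι : Type*} [Finite ι] (x : ι → A) : (affineSpan k x).FG :=
  Submodule.fg_span ((Set.finite_range x).insert 1)

/-- Since `1` lies in the span, its `s`-th power consists exactly of the values of polynomials of
degree at most `s`. This is one inclusion; `exists_aeval_eq_of_mem_affineSpan_pow` is the other. -/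
lemma aeval_mem_affineSpan_pow {ι : Type*} (x : ι → A) (p : MvPolynomial ι k) {s : ℕ}
    (hp : p.totalDegree ≤ s) : aeval x p ∈ affineSpan k x ^ s := by
  rw [p.as_sum, map_sum]
  refine Submodule.sum_mem _ fun γ hγ => ?_
  rw [aeval_monomial, ← Algebra.smul_def]
  refine Submodule.smul_mem _ _ ?_
  have hdeg : (Finsupp.toMultiset γ).card ≤ s := by
    rw [Finsupp.card_toMultiset]
    exact (le_totalDegree hγ).trans hp
  have key : ∀ m : Multiset ι, (m.map x).prod ∈ affineSpan k x ^ m.card := by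
    intro m
    induction m using Multiset.induction with
    | empty => simpa using ⟨1, map_one _⟩
    | cons i m ih =>
      rw [Multiset.map_cons, Multiset.prod_cons, Multiset.card_cons, pow_succ']
      exact Submodule.mul_mem_mul (mem_affineSpan x i) ih
  have := pow_le_pow_right' (one_le_affineSpan (k := k) x) hdeg (key _)
  rwa [Finsupp.toMultiset_map, Finsupp.prod_toMultiset, Finsupp.prod_mapDomain_index] at this
  · simp
  · intro _ _ _; rw [pow_add]

end AffineSpan

/-! ### Noether normalization by linear forms, via reductions. -/

section Noether

variable {k A : Type*} [Field k] [CommRing A] [Algebra k A]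

lemma exists_aeval_eq_of_mem_affineSpan_pow {ι : Type*} (x : ι → A) (s : ℕ) {a : A}
    (ha : a ∈ affineSpan k x ^ s) :
    ∃ g : MvPolynomial ι k, g.totalDegree ≤ s ∧ aeval x g = a := by
  suffices h : affineSpan k x ^ s ≤ (restrictTotalDegree ι k s).map (aeval x).toLinearMap by
    obtain ⟨g, hg, rfl⟩ := h ha
    exact ⟨g, (mem_restrictTotalDegree _ _ _).1 hg, rfl⟩
  clear ha
  induction s with
  | zero =>
    rw [pow_zero, Submodule.one_le]
    exact ⟨1, (mem_restrictTotalDegree _ _ _).2 (by simp), by simp⟩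
  | succ s ih =>
    rw [pow_succ']
    refine (mul_le_mul' le_rfl ih).trans (Submodule.mul_le.2 ?_)
    rintro u hu _ ⟨g, hg, rfl⟩
    have hg' : g.totalDegree ≤ s := (mem_restrictTotalDegree _ _ _).1 hg
    induction hu using Submodule.span_induction with
    | mem u hu =>
      rcases hu with rfl | ⟨i, rfl⟩
      · exact ⟨g, (mem_restrictTotalDegree _ _ _).2 (hg'.trans (Nat.le_succ s)), by simp⟩
      · refine ⟨X i * g, (mem_restrictTotalDegree _ _ _).2 ?_, by simp⟩
        refine (totalDegree_mul _ _).trans ?_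
        have := (totalDegree_X (R := k) i).le
        omega
    | zero => rw [zero_mul]; exact Submodule.zero_mem _
    | add u v _ _ hu hv => rw [add_mul]; exact Submodule.add_mem _ hu hv
    | smul c u _ hu => rw [smul_mul_assoc]; exact Submodule.smul_mem _ _ hu

lemma pow_add_le_of_reduction {L V : Submodule k A} {c : ℕ} (h : V ^ (c + 1) ≤ L * V ^ c) (s : ℕ) :
    V ^ (c + s) ≤ L ^ s * V ^ c := by
  induction s with
  | zero => simp
  | succ s ih =>
    calc V ^ (c + (s + 1)) = V * V ^ (c + s) := by rw [← pow_succ']; rfl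
      _ ≤ V * (L ^ s * V ^ c) := mul_le_mul' le_rfl ih
      _ = L ^ s * V ^ (c + 1) := by rw [pow_succ]; ring
      _ ≤ L ^ s * (L * V ^ c) := mul_le_mul' le_rfl h
      _ = L ^ (s + 1) * V ^ c := by rw [pow_succ]; ring

/-- Reductions compose. -/
lemma reduction_trans {M L V : Submodule k A} (hLV : L ≤ V)
    (h : ∃ c, L ^ (c + 1) ≤ M * L ^ c) (h' : ∃ c, V ^ (c + 1) ≤ L * V ^ c) :
    ∃ c, V ^ (c + 1) ≤ M * V ^ c := by
  obtain ⟨c, hc⟩ := h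
  obtain ⟨c', hc'⟩ := h'
  refine ⟨c + c', ?_⟩
  calc V ^ (c + c' + 1) = V ^ (c' + (c + 1)) := by ring_nf
    _ ≤ L ^ (c + 1) * V ^ c' := pow_add_le_of_reduction hc' _
    _ ≤ (M * L ^ c) * V ^ c' := mul_le_mul' hc le_rfl
    _ ≤ (M * V ^ c) * V ^ c' := 
        mul_le_mul' (mul_le_mul' le_rfl (pow_le_pow_left' hLV c)) le_rfl
    _ = M * V ^ (c + c') := by rw [mul_assoc, pow_add]

/-- Expand a product of `m + 1` elements of `L + k w`: every term except `w ^ (m + 1)` has a factor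
in `L`. -/
lemma reduction_of_pow_mem {L V : Submodule k A} {w : A} (hw1 : w ∈ V)
    (hV : V ≤ L ⊔ Submodule.span k {w}) {m : ℕ} (hw : w ^ (m + 1) ∈ L * V ^ m) :
    V ^ (m + 1) ≤ L * V ^ m := by
  have key : ∀ j, V ^ (j + 1) ≤ L * V ^ j ⊔ Submodule.span k {w ^ (j + 1)} := by
    intro j
    induction j with
    | zero => simpa using hV
    | succ j ih =>
      calc V ^ (j + 1 + 1) = V * V ^ (j + 1) := pow_succ' _ _
        _ ≤ V * (L * V ^ j ⊔ Submodule.span k {w ^ (j + 1)}) := mul_le_mul' le_rfl ih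
        _ = V * (L * V ^ j) ⊔ V * Submodule.span k {w ^ (j + 1)} := Submodule.mul_sup _ _ _
        _ ≤ L * V ^ (j + 1) ⊔ Submodule.span k {w ^ (j + 1 + 1)} := by
          refine sup_le ?_ ?_
          · rw [pow_succ']
            exact le_sup_of_le_left (le_of_eq (by ring))
          · calc V * Submodule.span k {w ^ (j + 1)}
                ≤ (L ⊔ Submodule.span k {w}) * Submodule.span k {w ^ (j + 1)} :=
                  mul_le_mul' hV le_rfl
              _ = L * Submodule.span k {w ^ (j + 1)} ⊔
                  Submodule.span k {w} * Submodule.span k {w ^ (j + 1)} := Submodule.sup_mul _ _ _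
              _ ≤ L * V ^ (j + 1) ⊔ Submodule.span k {w ^ (j + 1 + 1)} := by
                refine sup_le_sup (mul_le_mul' le_rfl ?_) (le_of_eq ?_)
                · exact (Submodule.span_singleton_le_iff_mem _ _).2 (Submodule.pow_mem_pow _ hw1 _)
                · rw [Submodule.span_mul_span, Set.singleton_mul_singleton, ← pow_succ']
  exact (key m).trans (sup_le le_rfl ((Submodule.span_singleton_le_iff_mem _ _).2 hw))

/-- Modulo `L * V ^ r` each factor `x j` of a product of `r + 1` coordinates may be replaced by `a j
• w`, one at a time. -/
lemma prod_sub_smul_pow_mem {ι : Type*} {L V : Submodule k A} {x : ι → A} {a : ι → k} {w : A}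
    (hLV : L ≤ V) (hw : w ∈ V) (hx : ∀ j, x j - a j • w ∈ L) (m : Multiset ι) :
    ∀ r, m.card = r + 1 → (m.map x).prod - (m.map a).prod • w ^ (r + 1) ∈ L * V ^ r := by
  have hxV : ∀ j, x j ∈ V := fun j => by
    have := V.add_mem (hLV (hx j)) (V.smul_mem (a j) hw)
    simpa using this
  induction m using Multiset.induction with
  | empty => intro r hr; simp at hr
  | cons i m ih =>
    intro r hr
    rw [Multiset.card_cons, Nat.add_right_cancel_iff] at hr
    simp only [Multiset.map_cons, Multiset.prod_cons]
    have hsplit : x i * (m.map x).prod - (a i * (m.map a).prod) • w ^ (r + 1) =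
        x i * ((m.map x).prod - (m.map a).prod • w ^ r) +
          (x i - a i • w) * ((m.map a).prod • w ^ r) := by
      simp only [Algebra.smul_def, map_mul]
      ring
    rw [hsplit]
    refine Submodule.add_mem _ ?_ (Submodule.mul_mem_mul (hx i)
      (Submodule.smul_mem _ _ (Submodule.pow_mem_pow _ hw _)))
    cases r with
    | zero =>
      rw [Multiset.card_eq_zero] at hr
      subst hr
      simp
    | succ r =>
      have := Submodule.mul_mem_mul (hxV i) (ih r hr)
      rwa [mul_left_comm, ← pow_succ'] at this

/-- Only the top form of `G` survives modulo `L * V ^ r`, and it is evaluated at `a`; terms of lower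
degree are absorbed because `1 ∈ L`. A relation `G(x) = 0` whose top form is nonzero at `a` thus
puts `w ^ (r + 1)` into `L * V ^ r`. -/
lemma aeval_sub_smul_pow_mem {ι : Type*} {L : Submodule k A} {x : ι → A} {a : ι → k} {w : A}
    (hLV : L ≤ affineSpan k x) (h1 : 1 ∈ L) (hw : w ∈ affineSpan k x)
    (hx : ∀ j, x j - a j • w ∈ L) {r : ℕ} {G : MvPolynomial ι k} (hG : G.totalDegree ≤ r + 1) :
    aeval x G - eval a (homogeneousComponent (r + 1) G) • w ^ (r + 1) ∈ L * affineSpan k x ^ r := by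
  classical
  have hmon : ∀ γ ∈ G.support, aeval x (monomial γ (coeff γ G)) -
      (if γ.degree = r + 1 then eval a (monomial γ (coeff γ G)) else 0) • w ^ (r + 1) ∈
        L * affineSpan k x ^ r := by
    intro γ hγ
    split_ifs with hd
    · have := prod_sub_smul_pow_mem hLV hw hx (Finsupp.toMultiset γ) r
        (by rw [Finsupp.card_toMultiset]; exact hd)
      rw [Finsupp.toMultiset_map, Finsupp.prod_toMultiset, Finsupp.prod_mapDomain_index (by simp)
        (fun _ _ _ => pow_add _ _ _), Finsupp.toMultiset_map, Finsupp.prod_toMultiset,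
        Finsupp.prod_mapDomain_index (by simp) (fun _ _ _ => pow_add _ _ _)] at this
      rw [aeval_monomial, eval_monomial, ← Algebra.smul_def, mul_smul, ← smul_sub]
      exact Submodule.smul_mem _ _ this
    · rw [zero_smul, sub_zero]
      have hle : (monomial γ (coeff γ G)).totalDegree ≤ r := by
        refine (totalDegree_monomial_le _ _).trans ?_
        have h1 := (le_totalDegree hγ).trans hG
        have h2 : γ.degree = γ.sum fun _ => id := rfl
        have h3 : (γ.sum fun _ e => e) = γ.sum fun _ => id := rfl
        omega
      have := Submodule.mul_mem_mul h1 (aeval_mem_affineSpan_pow x _ hle)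
      rwa [one_mul] at this
  have hsum : aeval x G - eval a (homogeneousComponent (r + 1) G) • w ^ (r + 1) =
      ∑ γ ∈ G.support, (aeval x (monomial γ (coeff γ G)) -
      (if γ.degree = r + 1 then eval a (monomial γ (coeff γ G)) else 0) • w ^ (r + 1)) := by
    rw [Finset.sum_sub_distrib, ← map_sum, ← G.as_sum, ← Finset.sum_smul, ← Finset.sum_filter,
      homogeneousComponent_apply, map_sum]
  rw [hsum]
  exact Submodule.sum_mem _ hmon

/-- Linear Noether normalization with control of degrees. -/
theorem exists_algebraicIndependent_reduction [Infinite k] [Nontrivial A] (n : ℕ) :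
    ∀ x : Fin n → A, ∃ (d : ℕ) (ℓ : Fin d → A), AlgebraicIndependent k ℓ ∧
      (∀ i, ℓ i ∈ affineSpan k x) ∧ ∃ c, affineSpan k x ^ (c + 1) ≤
        affineSpan k ℓ * affineSpan k x ^ c := by
  induction n with
  | zero =>
    intro x
    refine ⟨0, x, ?_, fun i => i.elim0, 0, by simp⟩
    rw [algebraicIndependent_empty_type_iff]
    exact (algebraMap k A).injective
  | succ n ih =>
    intro x
    by_cases hx : AlgebraicIndependent k x
    · exact ⟨n + 1, x, hx, mem_affineSpan x, 0, by simp⟩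
    rw [algebraicIndependent_iff] at hx
    push Not at hx
    obtain ⟨G, hG0, hG⟩ := hx
    obtain ⟨r, hr⟩ : ∃ r, G.totalDegree = r + 1 := by
      refine Nat.exists_eq_add_one_of_ne_zero fun h0 => hG ?_
      rw [totalDegree_eq_zero_iff_eq_C] at h0
      rw [h0, aeval_C, map_eq_zero_iff _ (algebraMap k A).injective] at hG0
      rw [h0, hG0, C_0]
    have htop : homogeneousComponent (r + 1) G ≠ 0 := by
      rw [← hr]
      obtain ⟨γ, hγ, hdeg⟩ := Finset.exists_mem_eq_sup G.support (support_nonempty.2 hG)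
        fun s => s.sum fun _ e => e
      intro h0
      have := congrArg (coeff γ) h0
      rw [coeff_homogeneousComponent, if_pos, coeff_zero] at this
      · exact mem_support_iff.1 hγ this
      · exact hdeg.symm
    -- A direction `a` off the zero set of the leading form exists since `k` is infinite.
    -- Eliminating along `a` makes the relation monic in `w`.
    obtain ⟨a, ha⟩ : ∃ a, eval a (homogeneousComponent (r + 1) G) ≠ 0 := by
      by_contra! hcon
      exact htop (MvPolynomial.funext fun c => by simpa using hcon c)
    obtain ⟨i, hi⟩ : ∃ i, a i ≠ 0 := by
      by_contra! hcon
      obtain rfl : a = 0 := _root_.funext hcon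
      apply ha
      have h0 := (homogeneousComponent_isHomogeneous (r + 1) G).coeff_eq_zero (d := 0) (by simp)
      rwa [← constantCoeff_eq, ← eval_zero] at h0
    -- With this `w` the `i`-th difference `x i - a i • w` vanishes, so `n` coordinates `x'` suffice
    -- and the induction applies.
    set w : A := (a i)⁻¹ • x i with hw
    set x' : Fin n → A := fun j => x (i.succAbove j) - a (i.succAbove j) • w with hx'
    have hwV : w ∈ affineSpan k x := Submodule.smul_mem _ _ (mem_affineSpan x i)
    have hx'V : ∀ j, x' j ∈ affineSpan k x := fun j =>
      Submodule.sub_mem _ (mem_affineSpan x _) (Submodule.smul_mem _ _ hwV)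
    have hLV : affineSpan k x' ≤ affineSpan k x := affineSpan_le (one_mem_affineSpan x) hx'V
    have hxL : ∀ j, x j - a j • w ∈ affineSpan k x' := by
      intro j
      rcases Fin.eq_self_or_eq_succAbove i j with rfl | ⟨j, rfl⟩
      · rw [hw, smul_smul, mul_inv_cancel₀ hi, one_smul, sub_self]
        exact Submodule.zero_mem _
      · exact mem_affineSpan x' j
    have hmem := aeval_sub_smul_pow_mem hLV (one_mem_affineSpan x') hwV hxL hr.le
    rw [hG0, zero_sub, ← neg_smul] at hmem
    have hred := reduction_of_pow_mem (L := affineSpan k x') hwV (affineSpan_le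
        (Submodule.mem_sup_left (one_mem_affineSpan x')) fun j => by
          have := Submodule.add_mem_sup (hxL j)
            (Submodule.smul_mem _ (a j) (Submodule.mem_span_singleton_self (R := k) w))
          rwa [sub_add_cancel] at this)
      ((Submodule.smul_mem_iff _ (neg_ne_zero.2 ha)).1 hmem)
    obtain ⟨d, ℓ, hℓ, hℓx, hc⟩ := ih x'
    exact ⟨d, ℓ, hℓ, fun i => hLV (hℓx i), reduction_trans hLV hc ⟨r, hred⟩⟩

end Noether

/-! ### Independence over a polynomial subalgebra. -/

section PolyComb

variable {k A : Type*} [CommRing k] [CommRing A] [Algebra k A]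

/-- The map `(g m) ↦ ∑ m, g m (ℓ) * y m`. -/
noncomputable def polyComb (k : Type*) {A : Type*} [CommRing k] [CommRing A] [Algebra k A]
    {ι μ : Type*} [Fintype μ] (ℓ : ι → A) (y : μ → A) : (μ → MvPolynomial ι k) →ₗ[k] A :=
  ∑ m, LinearMap.mulRight k (y m) ∘ₗ (aeval ℓ).toLinearMap ∘ₗ LinearMap.proj m

lemma polyComb_apply {ι μ : Type*} [Fintype μ] (ℓ : ι → A) (y : μ → A)
    (g : μ → MvPolynomial ι k) : polyComb k ℓ y g = ∑ m, aeval ℓ (g m) * y m := by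
  simp [polyComb]

/-- Independence over `k[ℓ]` becomes `k`-linear independence of monomials times `y`, a form suited
to tensor products and to specialization. -/
lemma injective_polyComb_iff {ι μ : Type*} [Fintype μ] {ℓ : ι → A} {y : μ → A} :
    Function.Injective (polyComb k ℓ y) ↔ LinearIndependent k
      fun p : Σ _ : μ, (ι →₀ ℕ) => aeval ℓ (monomial p.2 (1 : k)) * y p.1 := by
  classical
  let b := Pi.basis fun _ : μ => basisMonomials ι k
  have hb : (fun p : Σ _ : μ, (ι →₀ ℕ) => aeval ℓ (monomial p.2 (1 : k)) * y p.1) =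
      polyComb k ℓ y ∘ b := by
    funext p
    rw [Function.comp_apply, Pi.basis_apply, polyComb_apply, Finset.sum_eq_single p.1]
    · simp
    · intro m _ hm
      simp [hm]
    · simp
  rw [hb]
  constructor
  · intro h
    exact b.linearIndependent.map' _ (LinearMap.ker_eq_bot.2 h)
  · intro h
    rw [← LinearMap.ker_eq_bot]
    refine LinearMap.ker_eq_bot'.2 fun g hg => ?_
    rw [← b.linearCombination_repr g, ← LinearMap.comp_apply] at hg
    have h2 := linearIndependent_iff.1 h (b.repr g) (by
      rw [← hg, LinearMap.comp_apply, Finsupp.apply_linearCombination])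
    exact (map_eq_zero_iff _ b.repr.injective).1 h2

end PolyComb

/-! ### Noether frames: existence, transport and products. -/

section Frame

variable {k A : Type*} [Field k] [CommRing A] [Algebra k A]

lemma polyComb_mul {ι μ : Type*} [Fintype μ] (ℓ : ι → A) (y : μ → A)
    (p : MvPolynomial ι k) (g : μ → MvPolynomial ι k) :
    polyComb k ℓ y (fun m => p * g m) = aeval ℓ p * polyComb k ℓ y g := by
  simp [polyComb_apply, Finset.mul_sum, mul_assoc]

lemma map_polyComb {B : Type*} [CommRing B] [Algebra k B] (φ : A →ₐ[k] B) {ι μ : Type*} [Fintype μ]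
    (ℓ : ι → A) (y : μ → A) (g : μ → MvPolynomial ι k) :
    φ (polyComb k ℓ y g) = polyComb k (φ ∘ ℓ) (φ ∘ y) g := by
  simp only [polyComb_apply, map_sum, map_mul, Function.comp_apply]
  refine Finset.sum_congr rfl fun m _ => ?_
  congr 1
  exact DFunLike.congr_fun (comp_aeval ℓ φ) (g m)

/-- The combinations of the `y m` with coefficients polynomials of degree at most `s` in `ℓ`. -/
noncomputable def degreeComb (k : Type*) {A : Type*} [Field k] [CommRing A] [Algebra k A]
    {ι μ : Type*} [Fintype μ] (ℓ : ι → A) (y : μ → A) (s : ℕ) : Submodule k A :=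
  (Submodule.pi Set.univ fun _ => restrictTotalDegree ι k s).map (polyComb k ℓ y)

lemma mem_degreeComb {ι μ : Type*} [Fintype μ] {ℓ : ι → A} {y : μ → A} {s : ℕ} {a : A} :
    a ∈ degreeComb k ℓ y s ↔
      ∃ g : μ → MvPolynomial ι k, (∀ m, (g m).totalDegree ≤ s) ∧ polyComb k ℓ y g = a := by
  simp [degreeComb, Submodule.mem_map, Submodule.mem_pi, mem_restrictTotalDegree]

/-- Noether normalization data for a `k`-algebra filtered by the powers of a subspace `V`:
parameters `ℓ` in `V`, a family `e` that is linearly independent over `k[ℓ]`, and a finite family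
of generators `y` over `k[ℓ]` that generates in a way compatible with degrees and that is mapped
into the span of `e` by a nonzero polynomial `f` in `ℓ`. -/
structure NoetherFrame (V : Submodule k A) {ι κ μ : Type*} [Fintype κ] [Fintype μ] (ℓ : ι → A)
    (e : κ → A) (y : μ → A) (f : MvPolynomial ι k) : Prop where
  param_mem : ∀ i, ℓ i ∈ V
  basis_mem : ∃ c, ∀ i, e i ∈ V ^ c
  gen_mem : ∃ c, ∀ m, y m ∈ V ^ c
  ne_zero : f ≠ 0
  injective : Function.Injective (polyComb k ℓ e)
  generate : ∀ s, V ^ s ≤ degreeComb k ℓ y s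
  mem_range : ∀ m, aeval ℓ f * y m ∈ LinearMap.range (polyComb k ℓ e)

/-- Every finitely generated algebra over an infinite field has a frame. -/
theorem exists_noetherFrame [Infinite k] [Nontrivial A] {n : ℕ} (x : Fin n → A) :
    ∃ (d δ M : ℕ) (ℓ : Fin d → A) (e : Fin δ → A) (y : Fin M → A) (f : MvPolynomial (Fin d) k),
      0 < δ ∧ NoetherFrame (affineSpan k x) ℓ e y f := by
  classical
  obtain ⟨d, ℓ, hℓ, hℓx, c, hc⟩ := exists_algebraicIndependent_reduction (k := k) n x
  obtain ⟨M, y, hy⟩ := Submodule.fg_iff_exists_fin_generating_family.1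
    ((affineSpan_fg (k := k) x).pow c)
  have hgen : ∀ s, affineSpan k x ^ s ≤ degreeComb k ℓ y s := by
    intro s
    have h1 : affineSpan k x ^ s ≤ affineSpan k ℓ ^ s * affineSpan k x ^ c :=
      (pow_le_pow_right' (one_le_affineSpan (k := k) x) (Nat.le_add_left s c)).trans
        (pow_add_le_of_reduction hc s)
    refine h1.trans (Submodule.mul_le.2 ?_)
    rintro u hu v hv
    obtain ⟨g, hg, rfl⟩ := exists_aeval_eq_of_mem_affineSpan_pow ℓ s hu
    rw [← hy, Submodule.mem_span_range_iff_exists_fun] at hv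
    obtain ⟨a, rfl⟩ := hv
    refine mem_degreeComb.2 ⟨fun m => a m • g, fun m => (totalDegree_smul_le _ _).trans hg, ?_⟩
    simp [polyComb_apply, Finset.mul_sum]
  let : Algebra (MvPolynomial (Fin d) k) A := (aeval ℓ).toAlgebra
  have hsmul : ∀ (p : MvPolynomial (Fin d) k) (a : A), p • a = aeval ℓ p * a := fun p a => rfl
  -- The family `e` is a maximal independent subfamily of the generators `y`; the product of the
  -- multipliers `a i` found by maximality serves as `f`.
  obtain ⟨s, hs, hmax⟩ := exists_maximal_linearIndepOn (MvPolynomial (Fin d) k) y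
  have hex : ∀ i, ∃ a : MvPolynomial (Fin d) k, a ≠ 0 ∧
      a • y i ∈ Submodule.span (MvPolynomial (Fin d) k) (y '' s) := by
    intro i
    by_cases hi : i ∈ s
    · exact ⟨1, one_ne_zero, by rw [one_smul]; exact Submodule.subset_span ⟨i, hi, rfl⟩⟩
    · exact hmax i hi
  choose a ha0 ha using hex
  let E := Fintype.equivFin s
  let e : Fin (Fintype.card s) → A := fun i => y (E.symm i)
  have hspan : ∀ b ∈ Submodule.span (MvPolynomial (Fin d) k) (y '' s),
      b ∈ LinearMap.range (polyComb k ℓ e) := by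
    intro b hb
    have himg : y '' s = Set.range e := by
      ext z
      constructor
      · rintro ⟨i, hi, rfl⟩
        exact ⟨E ⟨i, hi⟩, by simp [e]⟩
      · rintro ⟨i, rfl⟩
        exact ⟨_, (E.symm i).2, rfl⟩
    rw [himg, Submodule.mem_span_range_iff_exists_fun] at hb
    obtain ⟨q, rfl⟩ := hb
    exact ⟨q, by simp [polyComb_apply, hsmul]⟩
  have hinj : Function.Injective (polyComb k ℓ e) := by
    rw [← LinearMap.ker_eq_bot, LinearMap.ker_eq_bot']
    intro q hq
    have he : LinearIndependent (MvPolynomial (Fin d) k) e :=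
      LinearIndependent.comp hs E.symm E.symm.injective
    rw [polyComb_apply] at hq
    funext i
    exact Fintype.linearIndependent_iff.1 he q hq i
  have hmem : ∀ m, aeval ℓ (∏ i, a i) * y m ∈ LinearMap.range (polyComb k ℓ e) := by
    intro m
    refine hspan _ ?_
    rw [← hsmul, ← Finset.prod_erase_mul _ _ (Finset.mem_univ m), mul_smul]
    exact Submodule.smul_mem _ _ (ha m)
  have hne : ∏ i, a i ≠ 0 := Finset.prod_ne_zero_iff.2 fun i _ => ha0 i
  have hyc : ∀ m, y m ∈ affineSpan k x ^ c := fun m => by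
    rw [← hy]; exact Submodule.subset_span ⟨m, rfl⟩
  refine ⟨d, Fintype.card s, M, ℓ, e, y, ∏ i, a i, ?_, hℓx, ⟨c, fun i => hyc _⟩,
    ⟨c, hyc⟩, hne, hinj, hgen, hmem⟩
  -- If `e` were empty, `f(ℓ)` would kill every `y m` and hence `1`, against the algebraic
  -- independence of `ℓ`.
  by_contra h0
  obtain ⟨g, -, hg⟩ := mem_degreeComb.1 (hgen 0 (by rw [pow_zero]; exact Submodule.one_le.1 le_rfl))
  have hz : ∀ m, aeval ℓ (∏ i, a i) * y m = 0 := by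
    intro m
    obtain ⟨q, hq⟩ := hmem m
    rw [← hq, polyComb_apply]
    have : IsEmpty (Fin (Fintype.card s)) := by
      rw [Nat.eq_zero_of_not_pos h0]; infer_instance
    simp
  have h1 : aeval ℓ (∏ i, a i) = 0 := by
    have := polyComb_mul ℓ y (∏ i, a i) g
    rw [hg, mul_one] at this
    rw [← this, polyComb_apply]
    refine Finset.sum_eq_zero fun m _ => ?_
    rw [mul_comm (∏ i, a i), map_mul, mul_assoc, hz, mul_zero]
  exact hne ((algebraicIndependent_iff.1 hℓ) _ h1)

/-- Frames descend along injective homomorphisms. -/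
lemma NoetherFrame.of_map {B : Type*} [CommRing B] [Algebra k B] {φ : A →ₐ[k] B}
    (hφ : Function.Injective φ) {V : Submodule k A} {ι κ μ : Type*} [Fintype κ] [Fintype μ]
    {ℓ : ι → B} {e : κ → B} {y : μ → B} {f : MvPolynomial ι k}
    (h : NoetherFrame (V.map φ.toLinearMap) ℓ e y f) :
    ∃ (ℓ : ι → A) (e : κ → A) (y : μ → A), NoetherFrame V ℓ e y f := by
  obtain ⟨c, hc⟩ := h.basis_mem
  obtain ⟨c', hc'⟩ := h.gen_mem
  have hp := h.param_mem
  simp only [← Submodule.map_pow] at hc hc'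
  choose ℓ' hℓV hℓ using hp
  choose e' heV he using hc
  choose y' hyV hy using hc'
  obtain rfl : φ ∘ ℓ' = ℓ := funext hℓ
  obtain rfl : φ ∘ e' = e := funext he
  obtain rfl : φ ∘ y' = y := funext hy
  refine ⟨ℓ', e', y', hℓV, ⟨c, heV⟩, ⟨c', hyV⟩, h.ne_zero, ?_, ?_, ?_⟩
  · intro g g' hg
    apply h.injective
    rw [← map_polyComb, hg, map_polyComb]
  · intro s a ha
    have := h.generate s (by rw [← Submodule.map_pow]; exact ⟨a, ha, rfl⟩)
    obtain ⟨g, hg, hga⟩ := mem_degreeComb.1 this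
    refine mem_degreeComb.2 ⟨g, hg, hφ ?_⟩
    rw [map_polyComb, hga]; rfl
  · intro m
    obtain ⟨q, hq⟩ := h.mem_range m
    refine ⟨q, hφ ?_⟩
    rw [map_polyComb, hq, map_mul]
    congr 1
    exact (DFunLike.congr_fun (comp_aeval ℓ' φ) f).symm

lemma polyComb_comp_symm {ι ι' μ : Type*} [Fintype μ] (E : ι ≃ ι') (ℓ : ι → A) (y : μ → A)
    (g : μ → MvPolynomial ι' k) :
    polyComb k (ℓ ∘ E.symm) y g = polyComb k ℓ y fun i => rename E.symm (g i) := by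
  simp [polyComb_apply, aeval_rename]

lemma polyComb_comp_symm_rename {ι ι' μ : Type*} [Fintype μ] (E : ι ≃ ι') (ℓ : ι → A) (y : μ → A)
    (g : μ → MvPolynomial ι k) :
    polyComb k (ℓ ∘ E.symm) y (fun i => rename E (g i)) = polyComb k ℓ y g := by
  rw [polyComb_comp_symm]
  simp [rename_rename]

lemma NoetherFrame.reindex_param {V : Submodule k A} {ι ι' κ μ : Type*} [Fintype κ] [Fintype μ]
    {ℓ : ι → A} {e : κ → A} {y : μ → A} {f : MvPolynomial ι k}
    (h : NoetherFrame V ℓ e y f) (E : ι ≃ ι') :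
    NoetherFrame V (ℓ ∘ E.symm) e y (rename E f) := by
  refine ⟨fun i => h.param_mem _, h.basis_mem, h.gen_mem, ?_, ?_, ?_, ?_⟩
  · exact (map_ne_zero_iff _ (rename_injective _ E.injective)).2 h.ne_zero
  · intro g g' hg
    rw [polyComb_comp_symm, polyComb_comp_symm] at hg
    funext i
    exact rename_injective _ E.symm.injective (congrFun (h.injective hg) i)
  · intro s a ha
    obtain ⟨g, hg, hga⟩ := mem_degreeComb.1 (h.generate s ha)
    exact mem_degreeComb.2 ⟨_, fun m => (totalDegree_rename_le _ _).trans (hg m),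
      (polyComb_comp_symm_rename E ℓ y g).trans hga⟩
  · intro m
    obtain ⟨q, hq⟩ := h.mem_range m
    refine ⟨_, (polyComb_comp_symm_rename E ℓ e q).trans ?_⟩
    rw [hq, aeval_rename, Function.comp_assoc, Equiv.symm_comp_self, Function.comp_id]

lemma aeval_sumElim_rename_inl {B C : Type*} [CommRing B] [Algebra k B] [CommRing C] [Algebra k C]
    (φ : A →ₐ[k] C) (ψ : B →ₐ[k] C) {ι ι' : Type*} (ℓ : ι → A) (ℓ' : ι' → B)
    (p : MvPolynomial ι k) :
    aeval (Sum.elim (φ ∘ ℓ) (ψ ∘ ℓ')) (rename Sum.inl p) = φ (aeval ℓ p) := by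
  rw [aeval_rename, Sum.elim_comp_inl]
  exact (DFunLike.congr_fun (comp_aeval ℓ φ) p).symm

lemma aeval_sumElim_rename_inr {B C : Type*} [CommRing B] [Algebra k B] [CommRing C] [Algebra k C]
    (φ : A →ₐ[k] C) (ψ : B →ₐ[k] C) {ι ι' : Type*} (ℓ : ι → A) (ℓ' : ι' → B)
    (p : MvPolynomial ι' k) :
    aeval (Sum.elim (φ ∘ ℓ) (ψ ∘ ℓ')) (rename Sum.inr p) = ψ (aeval ℓ' p) := by
  rw [aeval_rename, Sum.elim_comp_inr]
  exact (DFunLike.congr_fun (comp_aeval ℓ' ψ) p).symm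

lemma polyComb_prod {B C : Type*} [CommRing B] [Algebra k B] [CommRing C] [Algebra k C]
    (φ : A →ₐ[k] C) (ψ : B →ₐ[k] C) {ι ι' μ μ' : Type*} [Fintype μ] [Fintype μ'] (ℓ : ι → A)
    (ℓ' : ι' → B) (y : μ → A) (y' : μ' → B) (g : μ → MvPolynomial ι k)
    (g' : μ' → MvPolynomial ι' k) :
    polyComb k (Sum.elim (φ ∘ ℓ) (ψ ∘ ℓ')) (fun m : μ × μ' => φ (y m.1) * ψ (y' m.2))
      (fun m => rename Sum.inl (g m.1) * rename Sum.inr (g' m.2)) =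
      φ (polyComb k ℓ y g) * ψ (polyComb k ℓ' y' g') := by
  simp only [polyComb_apply, map_sum, map_mul, Finset.sum_mul_sum, aeval_sumElim_rename_inl,
    aeval_sumElim_rename_inr, Fintype.sum_prod_type]
  refine Finset.sum_congr rfl fun i _ => Finset.sum_congr rfl fun j _ => by ring

lemma sup_pow_le {V W T : Submodule k A} {s : ℕ}
    (h : ∀ i j, i + j = s → V ^ i * W ^ j ≤ T) : (V ⊔ W) ^ s ≤ T := by
  rw [← Submodule.add_eq_sup, (Commute.all V W).add_pow']
  refine Finset.sum_induction _ (· ≤ T) (fun a b ha hb => sup_le ha hb) bot_le ?_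
  rintro ⟨i, j⟩ hij
  have hij' := h i j (Finset.HasAntidiagonal.mem_antidiagonal.1 hij)
  -- Addition of submodules is the supremum, so the binomial coefficients act as repeated suprema.
  have : ∀ N : ℕ, N • (V ^ i * W ^ j) ≤ T := by
    intro N
    induction N with
    | zero => rw [zero_smul]; exact bot_le
    | succ N ih => rw [succ_nsmul]; exact sup_le ih hij'
  exact this _

/-- The frame of a product. -/
theorem NoetherFrame.prod {B C : Type*} [CommRing B] [Algebra k B] [CommRing C] [Algebra k C]
    (φ : A →ₐ[k] C) (ψ : B →ₐ[k] C) {V : Submodule k A} {W : Submodule k B} {ι ι' κ κ' μ μ' : Type}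
    [Fintype κ] [Fintype κ'] [Fintype μ] [Fintype μ'] {ℓ : ι → A} {e : κ → A} {y : μ → A}
    {f : MvPolynomial ι k} {ℓ' : ι' → B} {e' : κ' → B} {y' : μ' → B} {f' : MvPolynomial ι' k}
    (h : NoetherFrame V ℓ e y f) (h' : NoetherFrame W ℓ' e' y' f')
    (hli : ∀ {P Q : Type} (a : P → A) (b : Q → B), LinearIndependent k a →
      LinearIndependent k b → LinearIndependent k fun p : P × Q => φ (a p.1) * ψ (b p.2)) :
    NoetherFrame (V.map φ.toLinearMap ⊔ W.map ψ.toLinearMap) (Sum.elim (φ ∘ ℓ) (ψ ∘ ℓ'))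
      (fun i : κ × κ' => φ (e i.1) * ψ (e' i.2)) (fun m : μ × μ' => φ (y m.1) * ψ (y' m.2))
      (rename Sum.inl f * rename Sum.inr f') := by
  have hmul : ∀ {c c' : ℕ} {a : A} {b : B}, a ∈ V ^ c → b ∈ W ^ c' →
      φ a * ψ b ∈ (V.map φ.toLinearMap ⊔ W.map ψ.toLinearMap) ^ (c + c') := by
    intro c c' a b ha hb
    rw [pow_add]
    refine Submodule.mul_mem_mul
      ((pow_le_pow_left' le_sup_left c : V.map φ.toLinearMap ^ c ≤ _) ?_)
      ((pow_le_pow_left' le_sup_right c' : W.map ψ.toLinearMap ^ c' ≤ _) ?_)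
    · rw [← Submodule.map_pow]; exact ⟨a, ha, rfl⟩
    · rw [← Submodule.map_pow]; exact ⟨b, hb, rfl⟩
  obtain ⟨c, hc⟩ := h.basis_mem
  obtain ⟨c', hc'⟩ := h'.basis_mem
  obtain ⟨b, hb⟩ := h.gen_mem
  obtain ⟨b', hb'⟩ := h'.gen_mem
  refine ⟨?_, ⟨c + c', fun i => hmul (hc _) (hc' _)⟩, ⟨b + b', fun i => hmul (hb _) (hb' _)⟩,
    mul_ne_zero ((map_ne_zero_iff _ (rename_injective _ Sum.inl_injective)).2 h.ne_zero)
      ((map_ne_zero_iff _ (rename_injective _ Sum.inr_injective)).2 h'.ne_zero), ?_, ?_, ?_⟩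
  · rintro (i | i)
    · exact Submodule.mem_sup_left ⟨_, h.param_mem i, rfl⟩
    · exact Submodule.mem_sup_right ⟨_, h'.param_mem i, rfl⟩
  -- The hypothesis `hli` says that `φ ⊗ ψ` is injective in terms of families. A monomial in both
  -- sets of parameters is a product of one in each, so the required family is a reindexing of
  -- `key`.
  · have key := hli _ _ (injective_polyComb_iff.1 h.injective) (injective_polyComb_iff.1 h'.injective)
    rw [injective_polyComb_iff]
    let E : (Σ _ : κ × κ', (ι ⊕ ι' →₀ ℕ)) → (Σ _ : κ, (ι →₀ ℕ)) × (Σ _ : κ', (ι' →₀ ℕ)) := fun p =>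
      (⟨p.1.1, (Finsupp.sumFinsuppEquivProdFinsupp p.2).1⟩,
        ⟨p.1.2, (Finsupp.sumFinsuppEquivProdFinsupp p.2).2⟩)
    have hE : Function.Injective E := by
      rintro ⟨⟨i, i'⟩, γ⟩ ⟨⟨j, j'⟩, γ'⟩ hij
      simp only [E, Prod.mk.injEq, Sigma.mk.injEq, heq_eq_eq] at hij
      obtain ⟨⟨rfl, h1⟩, ⟨rfl, h2⟩⟩ := hij
      have : γ = γ' := Finsupp.sumFinsuppEquivProdFinsupp.injective (Prod.ext h1 h2)
      rw [this]
    convert key.comp E hE using 1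
    swap
    · rfl
    funext ⟨⟨i, i'⟩, γ⟩
    obtain ⟨⟨γ, γ'⟩, rfl⟩ := Finsupp.sumFinsuppEquivProdFinsupp.symm.surjective γ
    have hmon : monomial (Finsupp.sumFinsuppEquivProdFinsupp.symm (γ, γ')) (1 : k) =
        rename Sum.inl (monomial γ 1) * rename Sum.inr (monomial γ' 1) := by
      rw [rename_monomial, rename_monomial, monomial_mul, one_mul]
      refine congrArg (fun γ => monomial γ (1 : k)) (Finsupp.ext ?_)
      rintro (i | i)
      · simp [Finsupp.mapDomain_apply Sum.inl_injective, Finsupp.mapDomain_of_notMem_range]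
      · simp [Finsupp.mapDomain_apply Sum.inr_injective, Finsupp.mapDomain_of_notMem_range]
    simp only [E, Function.comp_apply, Equiv.apply_symm_apply, map_mul]
    rw [hmon, map_mul, aeval_sumElim_rename_inl, aeval_sumElim_rename_inr]
    ring
  · intro s
    refine sup_pow_le fun i j hij => ?_
    rw [← Submodule.map_pow, ← Submodule.map_pow, Submodule.mul_le]
    rintro _ ⟨a, ha, rfl⟩ _ ⟨b, hb, rfl⟩
    obtain ⟨g, hg, rfl⟩ := mem_degreeComb.1 (h.generate i ha)
    obtain ⟨g', hg', rfl⟩ := mem_degreeComb.1 (h'.generate j hb)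
    refine mem_degreeComb.2 ⟨_, fun m => ?_, polyComb_prod φ ψ ℓ ℓ' y y' g g'⟩
    refine (totalDegree_mul _ _).trans ?_
    have h1 := (totalDegree_rename_le (Sum.inl : ι → ι ⊕ ι') (g m.1)).trans (hg m.1)
    have h2 := (totalDegree_rename_le (Sum.inr : ι' → ι ⊕ ι') (g' m.2)).trans (hg' m.2)
    omega
  · intro m
    obtain ⟨q, hq⟩ := h.mem_range m.1
    obtain ⟨q', hq'⟩ := h'.mem_range m.2
    refine ⟨_, (polyComb_prod φ ψ ℓ ℓ' e e' q q').trans ?_⟩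
    rw [hq, hq', map_mul, map_mul, map_mul, aeval_sumElim_rename_inl, aeval_sumElim_rename_inr]
    ring

end Frame

/-! ### Counting monomials, and polynomial growth. -/

section Growth

/-- The number of monomials of degree at most `s`. -/
noncomputable def monomialCount (ι : Type*) (s : ℕ) : ℕ :=
  Nat.card {γ : ι →₀ ℕ | (γ.sum fun _ e => e) ≤ s}

variable {ι : Type*}

lemma degree_le_subset_pi (s : ℕ) {γ : ι →₀ ℕ} (hγ : (γ.sum fun _ e => e) ≤ s) (i : ι) :
    γ i < s + 1 := by
  refine Nat.lt_succ_of_le (le_trans ?_ hγ)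
  exact Finsupp.le_degree i γ

instance finite_degree_le [Finite ι] (s : ℕ) : Finite {γ : ι →₀ ℕ | (γ.sum fun _ e => e) ≤ s} := by
  refine Finite.of_injective
    (fun γ (i : ι) => (⟨γ.1 i, degree_le_subset_pi s γ.2 i⟩ : Fin (s + 1))) ?_
  intro γ γ' h
  ext i
  simpa using congrFun h i

lemma monomialCount_le [Finite ι] (s : ℕ) : monomialCount ι s ≤ (s + 1) ^ Nat.card ι := by
  have := Nat.card_le_card_of_injective
    (fun (γ : {γ : ι →₀ ℕ | (γ.sum fun _ e => e) ≤ s}) (i : ι) =>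
      (⟨γ.1 i, degree_le_subset_pi s γ.2 i⟩ : Fin (s + 1))) (by
    intro γ γ' h
    ext i
    simpa using congrFun h i)
  have _ := Fintype.ofFinite ι
  simpa [monomialCount, Nat.card_pi] using this

lemma monomialCount_mono [Finite ι] : Monotone (monomialCount ι) := by
  intro s t hst
  exact Nat.card_le_card_of_injective
    (Set.inclusion fun γ (hγ : _ ≤ s) => (hγ.trans hst : _ ≤ t)) (Set.inclusion_injective _)

lemma monomialCount_pos [Finite ι] (s : ℕ) : 0 < monomialCount ι s := by
  have : Nonempty {γ : ι →₀ ℕ | (γ.sum fun _ e => e) ≤ s} := ⟨0, by simp⟩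
  exact Nat.card_pos

lemma finrank_restrictTotalDegree {k : Type*} [Field k] (s : ℕ) :
    Module.finrank k (restrictTotalDegree ι k s) = monomialCount ι s :=
  Module.finrank_eq_nat_card_basis (basisRestrictSupport k _)

/-- A function of polynomial growth does not grow geometrically along an arithmetic progression. -/
lemma le_of_growth {N : ℕ → ℕ} {d : ℕ} (hpos : 0 < N 0) (hN : ∀ s, N s ≤ (s + 1) ^ d)
    {r δ M E : ℕ} (h : ∀ s, r * N s + M * N s ≤ (δ + M) * N (s + E)) : r ≤ δ := by
  by_contra! hr
  set q := δ + M with hq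
  -- If `r > δ`, each step by `E` multiplies `N` by at least `(q + 1) / q > 1`; iterating
  -- contradicts the polynomial bound `hN`.
  have hstep : ∀ s, (q + 1) * N s ≤ q * N (s + E) := fun s =>
    le_trans (by rw [← add_mul]; exact Nat.mul_le_mul_right _ (by omega)) (h s)
  have hiter : ∀ j, (q + 1) ^ j * N 0 ≤ q ^ j * N (j * E) := by
    intro j
    induction j with
    | zero => simp
    | succ j ih =>
      calc (q + 1) ^ (j + 1) * N 0 = (q + 1) * ((q + 1) ^ j * N 0) := by ring
        _ ≤ (q + 1) * (q ^ j * N (j * E)) := Nat.mul_le_mul_left _ ih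
        _ = q ^ j * ((q + 1) * N (j * E)) := by ring
        _ ≤ q ^ j * (q * N (j * E + E)) := Nat.mul_le_mul_left _ (hstep _)
        _ = q ^ (j + 1) * N ((j + 1) * E) := by ring_nf
  have hq0 : 0 < q := by
    rcases Nat.eq_zero_or_pos q with h0 | h0
    · have := hstep 0
      rw [h0] at this
      omega
    · exact h0
  have hqR : (0 : ℝ) < q := by exact_mod_cast hq0
  have hρ : (1 : ℝ) < (q + 1) / q := by
    rw [lt_div_iff₀ hqR]; linarith
  have hlim := tendsto_pow_const_div_const_pow_of_one_lt d hρ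
  have hev := hlim.eventually (gt_mem_nhds (show (0 : ℝ) < 1 / ((E : ℝ) + 1) ^ d by positivity))
  obtain ⟨j, hj, hj1⟩ := (hev.and (Filter.eventually_ge_atTop 1)).exists
  have h1 : ((q : ℝ) + 1) ^ j ≤ q ^ j * ((E + 1) ^ d * j ^ d) := by
    have h2 : (q + 1) ^ j ≤ q ^ j * ((E + 1) ^ d * j ^ d) := by
      calc (q + 1) ^ j ≤ (q + 1) ^ j * N 0 := Nat.le_mul_of_pos_right _ hpos
        _ ≤ q ^ j * N (j * E) := hiter j
        _ ≤ q ^ j * (j * E + 1) ^ d := Nat.mul_le_mul_left _ (hN _)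
        _ ≤ q ^ j * ((E + 1) ^ d * j ^ d) := by
          rw [← mul_pow]
          exact Nat.mul_le_mul_left _ (Nat.pow_le_pow_left (by nlinarith) d)
    exact_mod_cast h2
  rw [div_pow, div_lt_div_iff₀ (by positivity) (by positivity), one_mul,
    lt_div_iff₀ (by positivity)] at hj
  nlinarith

end Growth

/-! ### An upper bound for the Hilbert function. -/

section Hilbert

variable {k A : Type*} [Field k] [CommRing A] [Algebra k A]

/-- Write each coefficient of a generator as `f * u + v`, with `v` in a complement of the multiples
of `f`. The part `f * u * y m` is a combination of `e`, so only the `v` still need the generators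
`y`. They cost a difference of two monomial counts, which grows more slowly than the main term. -/
lemma NoetherFrame.finrank_pow_le {V : Submodule k A} {ι κ μ : Type*} [Finite ι] [Fintype κ]
    [Fintype μ] {ℓ : ι → A} {e : κ → A} {y : μ → A} {f : MvPolynomial ι k}
    (h : NoetherFrame V ℓ e y f) :
    ∃ c D : ℕ, ∀ s, Module.finrank k ↥(V ^ (s + D)) ≤ Fintype.card κ * monomialCount ι (s + D + c) +
      Fintype.card μ * (monomialCount ι (s + D) - monomialCount ι s) := by
  classical
  choose q hq using h.mem_range
  -- The shift `c` bounds the degrees of the coefficients of all `f(ℓ) * y m` with respect to `e`.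
  let c := Finset.univ.sup fun m => Finset.univ.sup fun i => (q m i).totalDegree
  have hc : ∀ m i, (q m i).totalDegree ≤ c := fun m i =>
    (Finset.le_sup (f := fun i => (q m i).totalDegree) (Finset.mem_univ i)).trans
      (Finset.le_sup (f := fun m => Finset.univ.sup fun i => (q m i).totalDegree)
        (Finset.mem_univ m))
  refine ⟨c, f.totalDegree, fun s => ?_⟩
  set D := f.totalDegree with hD
  obtain ⟨P, hP⟩ : ∃ P, P = restrictTotalDegree ι k (s + D) := ⟨_, rfl⟩
  have hPmem : ∀ {p}, p ∈ P ↔ p.totalDegree ≤ s + D := by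
    intro p; rw [hP, mem_restrictTotalDegree]
  have : Module.Finite k P := by rw [hP]; infer_instance
  have hPdim : Module.finrank k P = monomialCount ι (s + D) := by
    rw [hP, finrank_restrictTotalDegree]
  let F : restrictTotalDegree ι k s →ₗ[k] P :=
    ((LinearMap.mulLeft k f).comp (Submodule.subtype _)).codRestrict P fun g => by
      have := (mem_restrictTotalDegree _ _ _).1 g.2
      exact hPmem.2 ((totalDegree_mul f g.1).trans (by omega))
  have hF : Function.Injective F := by
    intro g g' hg
    have := congrArg Subtype.val hg
    exact Subtype.ext (mul_left_cancel₀ h.ne_zero this)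
  obtain ⟨C, hC⟩ := Submodule.exists_isCompl (LinearMap.range F)
  have hCdim : Module.finrank k C = monomialCount ι (s + D) - monomialCount ι s := by
    have h1 := Submodule.finrank_add_eq_of_isCompl hC
    rw [LinearMap.finrank_range_of_inj hF] at h1
    rw [finrank_restrictTotalDegree, hPdim] at h1
    omega
  obtain ⟨C', hC'⟩ : ∃ C', C' = C.map P.subtype := ⟨_, rfl⟩
  have hC'dim : Module.finrank k C' = monomialCount ι (s + D) - monomialCount ι s := by
    rw [hC', Submodule.finrank_map_subtype_eq, hCdim]
  have : Module.Finite k C' := by rw [hC']; infer_instance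
  let Φ : (κ → restrictTotalDegree ι k (s + D + c)) × (μ → C') →ₗ[k] A :=
    (polyComb k ℓ e ∘ₗ LinearMap.pi fun i => Submodule.subtype _ ∘ₗ LinearMap.proj i).coprod
      (polyComb k ℓ y ∘ₗ LinearMap.pi fun i => C'.subtype ∘ₗ LinearMap.proj i)
  have hrange : V ^ (s + D) ≤ LinearMap.range Φ := by
    intro a ha
    obtain ⟨g, hg, rfl⟩ := mem_degreeComb.1 (h.generate _ ha)
    have hsplit : ∀ m, ∃ u : restrictTotalDegree ι k s, ∃ v : C', g m = f * u + v := by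
      intro m
      have hm : (⟨g m, hPmem.2 (hg m)⟩ : P) ∈ LinearMap.range F ⊔ C := by
        rw [hC.sup_eq_top]; trivial
      obtain ⟨_, ⟨u, rfl⟩, v, hv, huv⟩ := Submodule.mem_sup.1 hm
      exact ⟨u, ⟨v, hC' ▸ ⟨v, hv, rfl⟩⟩, (congrArg Subtype.val huv).symm⟩
    choose u v huv using hsplit
    refine ⟨(fun i => ⟨∑ m, u m * q m i, (mem_restrictTotalDegree _ _ _).2 ?_⟩, v), ?_⟩
    · refine totalDegree_finsetSum_le fun m _ => (totalDegree_mul _ _).trans ?_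
      have h1 := (mem_restrictTotalDegree _ _ _).1 (u m).2
      have h2 := hc m i
      omega
    · simp only [Φ, LinearMap.coprod_apply, LinearMap.comp_apply]
      have h1 : polyComb k ℓ y g = (∑ m, aeval ℓ (u m : MvPolynomial ι k) *
          (aeval ℓ f * y m)) + polyComb k ℓ y fun m => (v m : MvPolynomial ι k) := by
        simp only [polyComb_apply, huv, map_add, map_mul, add_mul, Finset.sum_add_distrib]
        congr 1
        exact Finset.sum_congr rfl fun m _ => by ring
      rw [h1]
      congr 1
      simp only [← hq, ← polyComb_mul]
      rw [← map_sum]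
      congr 1
      funext i
      simp
  calc Module.finrank k ↥(V ^ (s + D)) ≤ Module.finrank k (LinearMap.range Φ) :=
        Submodule.finrank_mono hrange
    _ ≤ Module.finrank k ((κ → restrictTotalDegree ι k (s + D + c)) × (μ → C')) :=
        LinearMap.finrank_range_le Φ
    _ = _ := by
        rw [Module.finrank_prod, Module.finrank_pi_fintype, Module.finrank_pi_fintype]
        simp [finrank_restrictTotalDegree, hC'dim]

end Hilbert

attribute [local instance] MvPolynomial.algebraMvPolynomial

/-! ### Independence lifts from a specialization. -/

section Specialization

variable {k A : Type*} [CommRing k] [CommRing A] [Algebra k A] {σ : Type*}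

lemma mvPolynomial_smul_eq (p : MvPolynomial σ k) (g : MvPolynomial σ A) :
    p • g = map (algebraMap k A) p * g := Algebra.smul_def _ _

/-- In a relation, take an exponent `β` of least degree among all coefficients `p i`. The
coefficient of the relation at `β` involves only the constant terms of the `g i`, and gives a
relation between them. -/
lemma linearIndependent_of_coeff_zero {I : Type*} {g : I → MvPolynomial σ A}
    (h : LinearIndependent k fun i => coeff 0 (g i)) :
    LinearIndependent (MvPolynomial σ k) g := by
  classical
  rw [linearIndependent_iff']
  intro s p hp
  by_contra! hcon
  obtain ⟨i₀, hi₀, hne⟩ := hcon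
  obtain ⟨β, hβ, hmin⟩ := Finset.exists_min_image (s.biUnion fun i => (p i).support)
    Finsupp.degree (by
      obtain ⟨γ, hγ⟩ := support_nonempty.2 hne
      exact ⟨γ, Finset.mem_biUnion.2 ⟨i₀, hi₀, hγ⟩⟩)
  have hcoeff : ∀ i ∈ s, coeff β (p i • g i) = coeff β (p i) • coeff 0 (g i) := by
    intro i hi
    rw [mvPolynomial_smul_eq, coeff_mul, Finset.sum_eq_single (β, 0)]
    · rw [coeff_map, Algebra.smul_def]
    · rintro ⟨γ, γ'⟩ hγ hne'
      rw [Finset.HasAntidiagonal.mem_antidiagonal] at hγ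
      have hz : coeff γ (p i) = 0 := by
        by_contra hnz
        have h1 := hmin γ (Finset.mem_biUnion.2 ⟨i, hi, mem_support_iff.2 hnz⟩)
        have h2 : γ.degree + γ'.degree = β.degree := by rw [← hγ]; simp
        have h3 : γ' = 0 := (Finsupp.degree_eq_zero_iff γ').1 (by omega)
        subst h3
        simp only [add_zero] at hγ
        exact hne' (by rw [hγ])
      rw [coeff_map, hz, map_zero, zero_mul]
    · intro hnot
      exact absurd (by simp) hnot
  have hsum : ∑ i ∈ s, coeff β (p i) • coeff 0 (g i) = 0 := by
    rw [← Finset.sum_congr rfl hcoeff, ← coeff_sum, hp, coeff_zero]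
  obtain ⟨i, hi, hiβ⟩ := Finset.mem_biUnion.1 hβ
  exact mem_support_iff.1 hiβ (linearIndependent_iff'.1 h s _ hsum i hi)

/-- A family of polynomials is linearly independent if one of its specializations is. -/
lemma linearIndependent_of_eval {I : Type*} {g : I → MvPolynomial σ A} (v : σ → k)
    (h : LinearIndependent k fun i => eval (fun s => algebraMap k A (v s)) (g i)) :
    LinearIndependent (MvPolynomial σ k) g := by
  -- Translation moves the point `v` to the origin, where evaluation is the constant coefficient.
  let τ : MvPolynomial σ k →ₐ[k] MvPolynomial σ k := aeval fun s => X s + C (v s)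
  let τ' : MvPolynomial σ k →ₐ[k] MvPolynomial σ k := aeval fun s => X s - C (v s)
  let T : MvPolynomial σ A →ₐ[A] MvPolynomial σ A := aeval fun s => X s + C (algebraMap k A (v s))
  have hττ : ∀ p, τ' (τ p) = p := by
    intro p
    have : τ'.comp τ = AlgHom.id k _ := by
      apply MvPolynomial.algHom_ext
      intro s
      simp [τ, τ', algHom_C]
    exact DFunLike.congr_fun this p
  have hT : ∀ p : MvPolynomial σ k, T (map (algebraMap k A) p) = map (algebraMap k A) (τ p) := by
    intro p
    have : (T : MvPolynomial σ A →+* MvPolynomial σ A).comp (map (algebraMap k A)) =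
        (map (algebraMap k A)).comp (τ : MvPolynomial σ k →+* MvPolynomial σ k) := by
      apply MvPolynomial.ringHom_ext
      · intro a; simp [T, τ, algHom_C]
      · intro s; simp [T, τ]
    exact DFunLike.congr_fun this p
  have hT0 : ∀ q, coeff 0 (T q) = eval (fun s => algebraMap k A (v s)) q := by
    intro q
    have : constantCoeff.comp (T : MvPolynomial σ A →+* MvPolynomial σ A) =
        eval (fun s => algebraMap k A (v s)) := by
      apply MvPolynomial.ringHom_ext
      · intro a; simp [T, algHom_C]
      · intro s; simp [T]
    exact DFunLike.congr_fun this q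
  have key : LinearIndependent (MvPolynomial σ k) fun i => T (g i) := by
    refine linearIndependent_of_coeff_zero ?_
    simpa only [hT0] using h
  rw [linearIndependent_iff'] at key ⊢
  intro s p hp i hi
  have := key s (fun i => τ (p i)) (by
    simp only [mvPolynomial_smul_eq, ← hT, ← map_mul] at hp ⊢
    rw [← map_sum, hp, map_zero]) i hi
  rw [← hττ (p i), this, map_zero]

end Specialization

/-! ### The rank over generic linear forms. -/

section GenericForms

variable {k A : Type*} [Field k] [CommRing A] [Algebra k A]

/-- Translation is an automorphism of the polynomial ring. This removes the constant terms of the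
parameters, which the generic forms do not have. -/
lemma injective_polyComb_sub {ι κ : Type*} [Fintype κ] {ℓ : ι → A} {e : κ → A}
    (h : Function.Injective (polyComb k ℓ e)) (a : ι → k) :
    Function.Injective (polyComb k (fun i => ℓ i - algebraMap k A (a i)) e) := by
  let τ : MvPolynomial ι k →ₐ[k] MvPolynomial ι k := aeval fun s => X s - C (a s)
  let τ' : MvPolynomial ι k →ₐ[k] MvPolynomial ι k := aeval fun s => X s + C (a s)
  have hττ : ∀ p, τ' (τ p) = p := by
    intro p
    have : τ'.comp τ = AlgHom.id k _ := by
      apply MvPolynomial.algHom_ext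
      intro s
      simp [τ, τ', algHom_C]
    exact DFunLike.congr_fun this p
  have hτ : ∀ p, aeval ℓ (τ p) = aeval (fun i => ℓ i - algebraMap k A (a i)) p := by
    intro p
    have : (aeval ℓ).comp τ = aeval (fun i => ℓ i - algebraMap k A (a i)) := by
      apply MvPolynomial.algHom_ext
      intro s
      simp [τ]
    exact DFunLike.congr_fun this p
  intro g g' hg
  simp only [polyComb_apply, ← hτ] at hg
  rw [← polyComb_apply, ← polyComb_apply (g := fun i => τ (g' i))] at hg
  funext i
  rw [← hττ (g i), ← hττ (g' i)]
  exact congrArg τ' (congrFun (h hg) i)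

/-- The generic linear forms `tᵢ = ∑ⱼ cᵢⱼ xⱼ`, with indeterminate coefficients. -/
noncomputable def genericForm {n : ℕ} (d : ℕ) (x : Fin n → A) (i : Fin d) :
    MvPolynomial (Fin d × Fin n) A :=
  ∑ j, X (i, j) * C (x j)

lemma mem_affineSpan_iff {n : ℕ} {x : Fin n → A} {a : A} :
    a ∈ affineSpan k x ↔ ∃ (a₀ : k) (b : Fin n → k), a = algebraMap k A a₀ + ∑ j, b j • x j := by
  rw [affineSpan, Submodule.mem_span_insert]
  constructor
  · rintro ⟨a₀, z, hz, rfl⟩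
    obtain ⟨b, rfl⟩ := Submodule.mem_span_range_iff_exists_fun k |>.1 hz
    exact ⟨a₀, b, by rw [Algebra.algebraMap_eq_smul_one]⟩
  · rintro ⟨a₀, b, rfl⟩
    exact ⟨a₀, _, (Submodule.mem_span_range_iff_exists_fun k).2 ⟨b, rfl⟩, by
      rw [Algebra.algebraMap_eq_smul_one]⟩

/-- The family `e` of a frame is independent over the generic linear forms. -/
theorem NoetherFrame.injective_polyComb_genericForm {n d : ℕ} {x : Fin n → A} {κ μ : Type*}
    [Fintype κ] [Fintype μ] {ℓ : Fin d → A} {e : κ → A} {y : μ → A} {f : MvPolynomial (Fin d) k}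
    (h : NoetherFrame (affineSpan k x) ℓ e y f) :
    Function.Injective (polyComb (MvPolynomial (Fin d × Fin n) k) (genericForm d x)
      fun i => C (e i)) := by
  have hp := fun i => mem_affineSpan_iff.1 (h.param_mem i)
  choose a₀ b hb using hp
  rw [injective_polyComb_iff]
  -- At the coefficients `b` of the parameters, the generic forms specialize to `ℓ i` minus its
  -- constant term.
  refine linearIndependent_of_eval (fun s => b s.1 s.2) ?_
  have := injective_polyComb_iff.1 (injective_polyComb_sub h.injective a₀)
  convert this using 1
  funext p
  rw [map_mul, eval_C]
  congr 1
  rw [aeval_monomial, aeval_monomial, map_one, map_one, one_mul, one_mul, Finsupp.prod,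
    Finsupp.prod, map_prod]
  refine Finset.prod_congr rfl fun i _ => ?_
  rw [map_pow, hb i]
  simp [genericForm, Algebra.smul_def]

/-- After extension of scalars to polynomials, the `s`-th power still needs no more generators than
a basis of `V ^ s` has elements. -/
lemma span_C_image_pow_le (V : Submodule k A) (σ : Type*) (s : ℕ) :
    Submodule.span (MvPolynomial σ k) ((C : A → MvPolynomial σ A) '' V) ^ s ≤
      Submodule.span (MvPolynomial σ k) (C '' ((V ^ s : Submodule k A) : Set A)) := by
  induction s with
  | zero =>
    rw [pow_zero, pow_zero, Submodule.one_le]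
    exact Submodule.subset_span ⟨1, Submodule.one_le.1 le_rfl, map_one _⟩
  | succ s ih =>
    rw [pow_succ]
    refine (mul_le_mul' ih le_rfl).trans ?_
    rw [Submodule.span_mul_span, Submodule.span_le]
    rintro _ ⟨_, ⟨a, ha, rfl⟩, _, ⟨b, hb, rfl⟩, rfl⟩
    refine Submodule.subset_span ⟨a * b, ?_, map_mul _ _ _⟩
    rw [pow_succ]
    exact Submodule.mul_mem_mul ha hb

/-- Families that are independent over the generic linear forms are not larger than the family
`e` of a frame. -/
theorem NoetherFrame.card_le_of_injective {n d r : ℕ} {x : Fin n → A} {κ μ : Type*}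
    [Fintype κ] [Fintype μ] {ℓ : Fin d → A} {e : κ → A} {y : μ → A} {f : MvPolynomial (Fin d) k}
    (h : NoetherFrame (affineSpan k x) ℓ e y f) (hx : ∀ a, ∃ s, a ∈ affineSpan k x ^ s)
    (g : Fin r → MvPolynomial (Fin d × Fin n) A)
    (hg : Function.Injective
      (polyComb (MvPolynomial (Fin d × Fin n) k) (genericForm d x) g)) :
    r ≤ Fintype.card κ := by
  classical
  set V := affineSpan k x with hV
  set W := Submodule.span (MvPolynomial (Fin d × Fin n) k)
    ((C : A → MvPolynomial (Fin d × Fin n) A) '' V) with hW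
  have h1V : 1 ≤ V := one_le_affineSpan x
  have hCW : ∀ a ∈ V, (C a : MvPolynomial (Fin d × Fin n) A) ∈ W := fun a ha =>
    Submodule.subset_span ⟨a, ha, rfl⟩
  have h1W : 1 ≤ W := Submodule.one_le.2 (by
    simpa using hCW 1 (one_mem_affineSpan x))
  have hXW : ∀ (p : MvPolynomial (Fin d × Fin n) k) {s : ℕ} {w : MvPolynomial (Fin d × Fin n) A},
      w ∈ W ^ s → map (algebraMap k A) p * w ∈ W ^ s := fun p s w hw => by
    rw [← mvPolynomial_smul_eq]
    exact Submodule.smul_mem _ _ hw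
  have ht : affineSpan (MvPolynomial (Fin d × Fin n) k) (genericForm d x) ≤ W := by
    refine affineSpan_le (Submodule.one_le.1 h1W) fun i => Submodule.sum_mem _ fun j _ => ?_
    have := hXW (X (i, j)) (s := 1) (w := C (x j)) (by
      rw [pow_one]; exact hCW _ (mem_affineSpan x j))
    simpa using this
  have hCs : ∀ s, ∀ a ∈ V ^ s, (C a : MvPolynomial (Fin d × Fin n) A) ∈ W ^ s := by
    intro s
    induction s with
    | zero =>
      intro a ha
      obtain ⟨b, rfl⟩ := Submodule.mem_one.1 (by simpa using ha)
      have := hXW (C b) (s := 0) (w := 1) (by rw [pow_zero]; exact Submodule.one_le.1 le_rfl)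
      simpa using this
    | succ s ih =>
      intro a ha
      rw [pow_succ] at ha ⊢
      induction ha using Submodule.mul_induction_on' with
      | mem_mul_mem a ha b hb => rw [map_mul]; exact Submodule.mul_mem_mul (ih a ha) (hCW b hb)
      | add a _ b _ ha hb => rw [map_add]; exact Submodule.add_mem _ ha hb
  have hexh : ∀ q : MvPolynomial (Fin d × Fin n) A, ∃ s, q ∈ W ^ s := by
    intro q
    induction q using MvPolynomial.induction_on with
    | C a =>
      obtain ⟨s, hs⟩ := hx a
      exact ⟨s, hCs s a hs⟩
    | add p q hp hq =>
      obtain ⟨s, hs⟩ := hp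
      obtain ⟨s', hs'⟩ := hq
      exact ⟨max s s', Submodule.add_mem _ (pow_le_pow_right' h1W (le_max_left _ _) hs)
        (pow_le_pow_right' h1W (le_max_right _ _) hs')⟩
    | mul_X p i hp =>
      obtain ⟨s, hs⟩ := hp
      refine ⟨s, ?_⟩
      have := hXW (X i) hs
      rwa [map_X, mul_comm] at this
  choose cg hcg using fun i => hexh (g i)
  let c₀ := Finset.univ.sup cg
  have hgc : ∀ i, g i ∈ W ^ c₀ := fun i =>
    pow_le_pow_right' h1W (Finset.le_sup (Finset.mem_univ i)) (hcg i)
  -- The products of the `g i` with monomials of degree at most `s` in the generic forms are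
  -- independent and lie in `W ^ (s + c₀)`, which is spanned by a basis of `V ^ (s + c₀)`.
  have hcount : ∀ s, monomialCount (Fin d) s * r ≤ Module.finrank k ↥(V ^ (s + c₀)) := by
    intro s
    have hfg : (V ^ (s + c₀)).FG := (affineSpan_fg x).pow _
    have : Module.Finite k ↥(V ^ (s + c₀)) := Module.Finite.iff_fg.2 hfg
    let b := Module.finBasis k ↥(V ^ (s + c₀))
    let w : Finset (MvPolynomial (Fin d × Fin n) A) := Finset.univ.image fun i => C (b i : A)
    have hli := (injective_polyComb_iff.1 hg).comp
      (fun p : {γ : Fin d →₀ ℕ | (γ.sum fun _ e => e) ≤ s} × Fin r =>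
        (⟨p.2, p.1.1⟩ : Σ _ : Fin r, (Fin d →₀ ℕ))) (by
        rintro ⟨γ, i⟩ ⟨γ', i'⟩ hp
        simp only [Sigma.mk.injEq, heq_eq_eq] at hp
        exact Prod.ext (Subtype.ext hp.2) hp.1)
    have hle := linearIndependent_le_span' _ hli (w : Set (MvPolynomial (Fin d × Fin n) A)) (by
      rintro _ ⟨⟨⟨γ, hγ⟩, i⟩, rfl⟩
      have h1 : aeval (genericForm d x) (monomial γ (1 : MvPolynomial (Fin d × Fin n) k)) ∈
          W ^ s := by
        refine pow_le_pow_left' ht s (aeval_mem_affineSpan_pow _ _ ?_)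
        exact (totalDegree_monomial_le _ _).trans hγ
      have h2 := Submodule.mul_mem_mul h1 (hgc i)
      rw [← pow_add] at h2
      have h3 := span_C_image_pow_le V _ _ h2
      refine (Submodule.span_le.2 ?_ : _ ≤ Submodule.span _ (w : Set _)) h3
      rintro _ ⟨a, ha, rfl⟩
      have h4 := b.sum_repr ⟨a, ha⟩
      have h5 := congrArg Subtype.val h4
      simp only [Submodule.coe_sum, Submodule.coe_smul] at h5
      rw [← h5, map_sum]
      refine Submodule.sum_mem _ fun j _ => ?_
      rw [Algebra.smul_def, map_mul]
      have h6 : (C (algebraMap k A (b.repr ⟨a, ha⟩ j)) : MvPolynomial (Fin d × Fin n) A) * C (b j : A)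
          = (C (b.repr ⟨a, ha⟩ j) : MvPolynomial (Fin d × Fin n) k) • C (b j : A) := by
        rw [mvPolynomial_smul_eq, map_C]
      rw [h6]
      exact Submodule.smul_mem _ _ (Submodule.subset_span (by simp [w])))
    have hfin : Fintype.card (w : Set (MvPolynomial (Fin d × Fin n) A)) ≤
        Module.finrank k ↥(V ^ (s + c₀)) := by
      rw [← Set.toFinset_card, Finset.toFinset_coe]
      exact Finset.card_image_le.trans (by simp)
    have _ := Fintype.ofFinite {γ : Fin d →₀ ℕ | (γ.sum fun _ e => e) ≤ s}
    rw [Cardinal.mk_fintype, Nat.cast_le] at hle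
    refine le_trans ?_ (hle.trans hfin)
    rw [Fintype.card_prod, Fintype.card_fin, monomialCount, Nat.card_eq_fintype_card]
  -- This lower bound and the upper bound from the frame are compared; the shifts `c₀`, `D` and `c`
  -- together form the step `E` of `le_of_growth`.
  obtain ⟨c, D, hcD⟩ := h.finrank_pow_le
  refine le_of_growth (N := monomialCount (Fin d)) (d := Nat.card (Fin d)) (monomialCount_pos 0)
    monomialCount_le (M := Fintype.card μ) (E := c₀ + D + c) fun s => ?_
  have h1 := hcount (s + D)
  have h2 := hcD (s + c₀)
  have h3 : s + D + c₀ = s + c₀ + D := by ring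
  rw [h3] at h1
  have h4 := h1.trans h2
  have m1 := monomialCount_mono (ι := Fin d) (show s ≤ s + D by omega)
  have m2 := monomialCount_mono (ι := Fin d) (show s ≤ s + c₀ by omega)
  have m3 := monomialCount_mono (ι := Fin d) (show s + c₀ + D ≤ s + (c₀ + D + c) by omega)
  have m4 : s + c₀ + D + c = s + (c₀ + D + c) := by ring
  have m5 := monomialCount_mono (ι := Fin d) (show s + c₀ ≤ s + c₀ + D by omega)
  rw [m4] at h4
  generalize monomialCount (Fin d) s = N0 at *
  generalize monomialCount (Fin d) (s + D) = N1 at *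
  generalize monomialCount (Fin d) (s + c₀) = N2 at *
  generalize monomialCount (Fin d) (s + c₀ + D) = N3 at *
  generalize monomialCount (Fin d) (s + (c₀ + D + c)) = N4 at *
  -- The subtraction is not truncated, by `m5`; `N0 ≤ N2` and `N3 ≤ N4` give the bound.
  have h5 : Fintype.card μ * (N3 - N2) + Fintype.card μ * N0 ≤ Fintype.card μ * N4 := by
    rw [← mul_add]
    exact Nat.mul_le_mul_left _ (by omega)
  nlinarith [Nat.mul_le_mul_right r m1]

end GenericForms

/-! ### Counting points in general fibres. -/

section FiberCount

open TensorProduct nonZeroDivisors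

universe u

/-- One denominator `f` is chosen for `1`, for algebra generators of `S` and for all products `e i *
e j`. Multiplying two elements then costs the sum of their exponents plus one. -/
lemma exists_pow_smul_mem_span {R S κ : Type*} [CommRing R] [IsDomain R] [CommRing S] [Algebra R S]
    [Algebra.FiniteType R S] [Finite κ] (e : κ → S)
    (hmax : ∀ s : S, ∃ r : R, r ≠ 0 ∧ r • s ∈ Submodule.span R (Set.range e)) :
    ∃ f : R, f ≠ 0 ∧ ∀ s : S, ∃ N : ℕ, f ^ N • s ∈ Submodule.span R (Set.range e) := by
  classical
  have _ := Fintype.ofFinite κ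
  obtain ⟨G, hG⟩ := Algebra.FiniteType.out (R := R) (A := S)
  choose r hr0 hr using hmax
  set M := Submodule.span R (Set.range e) with hM
  let F : Finset S := insert 1 (G ∪ Finset.univ.image fun p : κ × κ => e p.1 * e p.2)
  let f := ∏ s ∈ F, r s
  have hf : ∀ s ∈ F, f • s ∈ M := by
    intro s hs
    simp only [f]
    rw [← Finset.prod_erase_mul F _ hs, mul_smul]
    exact Submodule.smul_mem _ _ (hr s)
  have hmono : ∀ {N N' : ℕ} {s : S}, N ≤ N' → f ^ N • s ∈ M → f ^ N' • s ∈ M := by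
    intro N N' s hN hs
    rw [← Nat.sub_add_cancel hN, pow_add, mul_smul]
    exact Submodule.smul_mem _ _ hs
  have hmul : ∀ a ∈ M, ∀ b ∈ M, f • (a * b) ∈ M := by
    intro a ha b hb
    induction ha using Submodule.span_induction with
    | zero => simp
    | add a a' _ _ ha ha' => rw [add_mul, smul_add]; exact Submodule.add_mem _ ha ha'
    | smul c a _ ha => rw [smul_mul_assoc, smul_comm]; exact Submodule.smul_mem _ _ ha
    | mem a ha =>
      obtain ⟨i, rfl⟩ := ha
      induction hb using Submodule.span_induction with
      | zero => simp
      | add a a' _ _ ha ha' => rw [mul_add, smul_add]; exact Submodule.add_mem _ ha ha'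
      | smul c a _ ha => rw [mul_smul_comm, smul_comm]; exact Submodule.smul_mem _ _ ha
      | mem b hb =>
        obtain ⟨j, rfl⟩ := hb
        refine hf _ (Finset.mem_insert_of_mem (Finset.mem_union_right _ ?_))
        exact Finset.mem_image.2 ⟨(i, j), Finset.mem_univ _, rfl⟩
  refine ⟨f, Finset.prod_ne_zero_iff.2 fun s _ => hr0 s, fun s => ?_⟩
  have hs : s ∈ Algebra.adjoin R (G : Set S) := by rw [hG]; trivial
  induction hs using Algebra.adjoin_induction with
  | mem s hs =>
    exact ⟨1, by
      rw [pow_one]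
      exact hf s (Finset.mem_insert_of_mem (Finset.mem_union_left _ hs))⟩
  | algebraMap a =>
    refine ⟨1, ?_⟩
    rw [pow_one, Algebra.algebraMap_eq_smul_one, smul_comm]
    exact Submodule.smul_mem _ _ (hf 1 (Finset.mem_insert_self _ _))
  | add a b _ _ ha hb =>
    obtain ⟨N, hN⟩ := ha
    obtain ⟨N', hN'⟩ := hb
    exact ⟨max N N', by
      rw [smul_add]
      exact Submodule.add_mem _ (hmono (le_max_left _ _) hN) (hmono (le_max_right _ _) hN')⟩
  | mul a b _ _ ha hb =>
    obtain ⟨N, hN⟩ := ha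
    obtain ⟨N', hN'⟩ := hb
    refine ⟨1 + (N + N'), ?_⟩
    have h := hmul _ hN _ hN'
    rwa [smul_mul_smul_comm, ← pow_add, smul_smul, ← pow_succ', add_comm] at h

/-- Over a nonempty open set, `S` has the expected rank. -/
lemma finrank_fiber {R S k κ : Type*} [CommRing R] [IsDomain R] [CommRing S] [Algebra R S]
    [Field k] [Algebra R k] [Fintype κ] {e : κ → S} (he : LinearIndependent R e) {f : R}
    (hf : ∀ s : S, ∃ N : ℕ, f ^ N • s ∈ Submodule.span R (Set.range e))
    (hfk : algebraMap R k f ≠ 0) :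
    Module.Finite k (k ⊗[R] S) ∧ Module.finrank k (k ⊗[R] S) = Fintype.card κ := by
  -- Over `R[1/f]` the algebra is free with basis `e`, and the given map to `k` factors through
  -- `R[1/f]`. The fibre is a base change of this free module.
  let Rf := Localization.Away f
  let ev : Rf →+* k := IsLocalization.Away.lift f (g := algebraMap R k) (isUnit_iff_ne_zero.2 hfk)
  let : Algebra Rf k := ev.toAlgebra
  have : IsScalarTower R Rf k := IsScalarTower.of_algebraMap_eq fun r =>
    (IsLocalization.Away.lift_eq f _ r).symm
  have hli : LinearIndependent Rf (TensorProduct.mk R Rf S 1 ∘ e) :=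
    he.of_isLocalizedModule Rf (Submonoid.powers f) (TensorProduct.mk R Rf S 1)
  have hspan : ⊤ ≤ Submodule.span Rf (Set.range (TensorProduct.mk R Rf S 1 ∘ e)) := by
    rintro z -
    induction z using TensorProduct.induction_on with
    | zero => exact Submodule.zero_mem _
    | add a b ha hb => exact Submodule.add_mem _ ha hb
    | tmul a s =>
      obtain ⟨N, hN⟩ := hf s
      have h1 : (1 : Rf) ⊗ₜ[R] (f ^ N • s) ∈
          Submodule.span Rf (Set.range (TensorProduct.mk R Rf S 1 ∘ e)) := by
        rw [Submodule.mem_span_range_iff_exists_fun] at hN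
        obtain ⟨c, hc⟩ := hN
        rw [← hc, TensorProduct.tmul_sum]
        refine Submodule.sum_mem _ fun i _ => ?_
        rw [TensorProduct.tmul_smul, ← algebraMap_smul Rf (c i)]
        exact Submodule.smul_mem _ _ (Submodule.subset_span ⟨i, rfl⟩)
      have hu : IsUnit (algebraMap R Rf (f ^ N)) := by
        rw [map_pow]
        exact (IsLocalization.Away.algebraMap_isUnit f).pow N
      obtain ⟨v, hv⟩ := hu.exists_left_inv
      have h2 : a ⊗ₜ[R] s = (a * v) • ((1 : Rf) ⊗ₜ[R] (f ^ N • s)) := by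
        rw [TensorProduct.tmul_smul, ← algebraMap_smul Rf (f ^ N), smul_smul, mul_assoc, hv,
          mul_one, TensorProduct.smul_tmul', smul_eq_mul, mul_one]
      rw [h2]
      exact Submodule.smul_mem _ _ h1
  let b : Module.Basis κ Rf (Rf ⊗[R] S) := Module.Basis.mk hli hspan
  let bas : Module.Basis κ k (k ⊗[R] S) := (b.baseChange k).map
    (TensorProduct.AlgebraTensorModule.cancelBaseChange R Rf k k S)
  exact ⟨Module.Finite.of_basis bas, Module.finrank_eq_card_basis bas⟩

/-- If `S` is generically unramified over `R`, then its differentials are killed by a nonzero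
element of `R`. -/
lemma exists_smul_kaehlerDifferential_eq_zero (R S K SK : Type*) [CommRing R] [IsDomain R]
    [CommRing S] [Algebra R S] [Algebra.FiniteType R S] [CommRing K] [Algebra R K]
    [IsLocalization R⁰ K]
    [CommRing SK] [Algebra R SK] [Algebra S SK] [Algebra K SK] [IsScalarTower R S SK]
    [IsScalarTower R K SK] [IsLocalization (Algebra.algebraMapSubmonoid S R⁰) SK]
    [Algebra.FormallyUnramified K SK] :
    ∃ f : R, f ≠ 0 ∧ ∀ ω : Ω[S⁄R], f • ω = 0 := by
  classical
  -- The differentials localize to those of `SK` over `K`, which vanish. So each is torsion, and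
  -- finitely many generate.
  have hloc : IsLocalizedModule R⁰ ((KaehlerDifferential.map R K S SK).restrictScalars R) :=
    inferInstance
  have hkill : ∀ ω : Ω[S⁄R], ∃ r : R, r ≠ 0 ∧ r • ω = 0 := by
    intro ω
    obtain ⟨c, hc⟩ := (IsLocalizedModule.eq_zero_iff R⁰
      ((KaehlerDifferential.map R K S SK).restrictScalars R) (m := ω)).1 (Subsingleton.elim _ _)
    exact ⟨c, nonZeroDivisors.ne_zero c.2, hc⟩
  choose r hr0 hr using hkill
  obtain ⟨G, hG⟩ := (Module.Finite.fg_top : (⊤ : Submodule S Ω[S⁄R]).FG)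
  refine ⟨∏ ω ∈ G, r ω, Finset.prod_ne_zero_iff.2 fun s _ => hr0 s, fun ω => ?_⟩
  have hω : ω ∈ Submodule.span S (G : Set Ω[S⁄R]) := by rw [hG]; trivial
  induction hω using Submodule.span_induction with
  | zero => simp
  | add a b _ _ ha hb => rw [smul_add, ha, hb, add_zero]
  | smul s a _ ha => rw [smul_comm, ha, smul_zero]
  | mem a ha => rw [← Finset.prod_erase_mul G _ ha, mul_smul, hr, smul_zero]

/-- A finite unramified algebra over an algebraically closed field is a product of copies of the
field, one for each prime. -/
lemma card_algHom_of_formallyUnramified (k T : Type u) [Field k] [IsAlgClosed k] [CommRing T]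
    [Algebra k T] [Module.Finite k T] [Algebra.FormallyUnramified k T] :
    Nat.card (T →ₐ[k] k) = Module.finrank k T := by
  have : Algebra.FormallyEtale k T := Algebra.FormallyEtale.of_formallyUnramified_of_field k T
  have : IsArtinianRing T := isArtinian_of_tower k inferInstance
  have _ := Fintype.ofFinite (PrimeSpectrum T)
  rw [Nat.card_congr (Algebra.IsFiniteSplit.algHomEquivPrimeSpectrum k T),
    (Algebra.FormallyEtale.equivPiOfIsSepClosed k T).toLinearEquiv.finrank_eq,
    Module.finrank_pi, Nat.card_eq_fintype_card]

/-- The number of points in the general fiber of a generically finite and unramified map. -/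
theorem exists_card_fiber_eq {R S k : Type u} {κ : Type*} [CommRing R] [IsDomain R] [CommRing S]
    [Algebra R S] [Algebra.FiniteType R S] [Field k] [IsAlgClosed k] [Fintype κ] {e : κ → S}
    (he : LinearIndependent R e)
    (hmax : ∀ s : S, ∃ r : R, r ≠ 0 ∧ r • s ∈ Submodule.span R (Set.range e))
    (hΩ : ∃ f : R, f ≠ 0 ∧ ∀ ω : Ω[S⁄R], f • ω = 0) :
    ∃ f : R, f ≠ 0 ∧ ∀ φ : R →+* k, φ f ≠ 0 →
      Nat.card {ψ : S →+* k // ψ.comp (algebraMap R S) = φ} = Fintype.card κ := by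
  obtain ⟨f₁, hf₁, h₁⟩ := exists_pow_smul_mem_span e hmax
  obtain ⟨f₂, hf₂, h₂⟩ := hΩ
  refine ⟨f₁ * f₂, mul_ne_zero hf₁ hf₂, fun φ hφ => ?_⟩
  rw [map_mul] at hφ
  let : Algebra R k := φ.toAlgebra
  obtain ⟨hfin, hrank⟩ := finrank_fiber (k := k) he h₁ (left_ne_zero_of_mul hφ)
  -- Differentials commute with base change; on those of the fibre `f₂` acts both as zero and as a
  -- unit.
  have hunr : Algebra.FormallyUnramified k (k ⊗[R] S) := by
    constructor
    let := Algebra.TensorProduct.rightAlgebra (R := R) (A := k) (B := S)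
    refine (KaehlerDifferential.tensorKaehlerEquivBase R k S (k ⊗[R] S)).symm.toEquiv.subsingleton_congr.2 ?_
    refine subsingleton_of_forall_eq 0 fun z => ?_
    induction z using TensorProduct.induction_on with
    | zero => rfl
    | add a b ha hb => rw [ha, hb, add_zero]
    | tmul a ω =>
      have h0 : algebraMap R k f₂ ≠ 0 := right_ne_zero_of_mul hφ
      have : a ⊗ₜ[R] ω = (a * (algebraMap R k f₂)⁻¹) ⊗ₜ[R] (f₂ • ω) := by
        rw [TensorProduct.tmul_smul, TensorProduct.smul_tmul', Algebra.smul_def]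
        congr 1
        field_simp
      rw [this, h₂, TensorProduct.tmul_zero]
  rw [← hrank, ← card_algHom_of_formallyUnramified]
  refine Nat.card_congr ?_
  let E₁ : {ψ : S →+* k // ψ.comp (algebraMap R S) = φ} ≃ (S →ₐ[R] k) :=
    { toFun := fun ψ => { ψ.1 with commutes' := fun r => DFunLike.congr_fun ψ.2 r }
      invFun := fun ψ => ⟨ψ, RingHom.ext fun r => ψ.commutes r⟩
      left_inv := fun ψ => rfl
      right_inv := fun ψ => rfl }
  let E₂ : (S →ₐ[R] k) ≃ (k ⊗[R] S →ₐ[k] k) :=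
    { toFun := fun ψ => Algebra.TensorProduct.lift (AlgHom.id k k) ψ fun _ _ => Commute.all _ _
      invFun := fun ψ => (ψ.restrictScalars R).comp Algebra.TensorProduct.includeRight
      left_inv := fun ψ => by ext; simp
      right_inv := fun ψ => by ext; simp }
  exact E₁.trans E₂

end FiberCount

/-! ### Generic projections are separable over a perfect field. -/

section Separability

universe u

lemma derivation_eq_zero_of_mem_adjoin {k F N : Type*} [Field k] [Field F] [Algebra k F]
    [AddCommGroup N] [Module k N] [Module F N] (D : Derivation k F N) {s : Set F}
    (hs : ∀ a ∈ s, D a = 0) {a : F} (ha : a ∈ IntermediateField.adjoin k s) : D a = 0 := by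
  induction ha using IntermediateField.adjoin_induction with
  | mem a ha => exact hs a ha
  | algebraMap a => exact D.map_algebraMap a
  | add a b _ _ ha hb => rw [map_add, ha, hb, add_zero]
  | inv a _ ha => rw [D.leibniz_inv, ha, smul_zero]
  | mul a b _ _ ha hb => rw [D.leibniz, ha, hb, smul_zero, smul_zero, add_zero]

/-- A derivation that vanishes on a separating transcendence basis vanishes. -/
lemma derivation_eq_zero_of_isSeparable {k F N : Type*} [Field k] [Field F] [Algebra k F]
    [AddCommGroup N] [Module k N] [Module F N] [IsScalarTower k F N] (D : Derivation k F N)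
    {s : Set F} [Algebra.IsSeparable (IntermediateField.adjoin k s) F] (hs : ∀ a ∈ s, D a = 0) :
    D = 0 := by
  have hD : ∀ a : IntermediateField.adjoin k s, D a = 0 := fun a =>
    derivation_eq_zero_of_mem_adjoin D hs a.2
  -- Vanishing on `s` makes `D` linear over the subfield generated by `s`, and a separable extension
  -- has no nonzero derivations.
  let D' : Derivation (IntermediateField.adjoin k s) F N := Derivation.mk'
    { toFun := D
      map_add' := map_add D
      map_smul' := fun a b => by
        rw [Algebra.smul_def, D.leibniz]
        change (a : F) • D b + b • D (a : F) = _
        rw [hD a, smul_zero, add_zero]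
        rfl } (fun a b => D.leibniz a b)
  have := Algebra.FormallyUnramified.of_isSeparable (IntermediateField.adjoin k s) F
  have h0 : D' = 0 := (KaehlerDifferential.linearMapEquivDerivation
    (IntermediateField.adjoin k s) F).symm.injective (LinearMap.ext fun z => by
      rw [Subsingleton.elim z 0, map_zero, map_zero])
  ext a
  exact DFunLike.congr_fun h0 a

/-- If the `cᵢⱼ` are independent over `k(x)`, of transcendence degree at most `d`, then a
derivation is determined by its values at the `cᵢⱼ` and at the `d` forms `∑ⱼ cᵢⱼ xⱼ`. -/
theorem derivation_eq_zero_of_generic {k E : Type u} [Field k] [PerfectField k] [Field E]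
    [Algebra k E] {n d : ℕ} (x : Fin n → E) (c : Fin d × Fin n → E)
    (hc : AlgebraicIndependent (IntermediateField.adjoin k (Set.range x)) c)
    (htr : Algebra.trdeg k (IntermediateField.adjoin k (Set.range x)) ≤ d)
    (D : Derivation k E E) (hD : ∀ i, ∑ j, c (i, j) * D (x j) = 0) (j : Fin n) : D (x j) = 0 := by
  classical
  set F := IntermediateField.adjoin k (Set.range x) with hF
  have : Algebra.EssFiniteType k F := IntermediateField.essFiniteType_iff.2
    (IntermediateField.fg_adjoin_of_finite (Set.finite_range x))
  obtain ⟨s, hs, hsep⟩ := exists_isTranscendenceBasis_and_isSeparable_of_perfectField k F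
  have hcard : s.card ≤ d := by
    have h := hs.cardinalMk_eq_trdeg
    rw [← h] at htr
    simpa using htr
  have hxF : ∀ j, x j ∈ F := fun j => IntermediateField.subset_adjoin _ _ ⟨j, rfl⟩
  -- Modulo the span `P` of its values on a separating transcendence basis, `D` vanishes on `F`. So
  -- the values of `D` on `F` lie in an `F`-space of dimension at most `d`.
  let P : Submodule F E := Submodule.span F ((fun a : F => D (a : E)) '' s)
  have hDP : ∀ a : F, D (a : E) ∈ P := by
    intro a
    have h0 := derivation_eq_zero_of_isSeparable (s := (s : Set F))
      (P.mkQ.compDer (D.compAlgebraMap F)) (fun a ha => by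
        change P.mkQ (D (a : E)) = 0
        rw [Submodule.mkQ_apply, Submodule.Quotient.mk_eq_zero]
        exact Submodule.subset_span ⟨a, ha, rfl⟩)
    have h1 := DFunLike.congr_fun h0 a
    change P.mkQ (D (a : E)) = 0 at h1
    rwa [Submodule.mkQ_apply, Submodule.Quotient.mk_eq_zero] at h1
  let v : Fin n → E := fun j => D (x j)
  -- The `D (x j)` with `j ∈ J` form a basis of the span of all of them, and `|J| ≤ d`. So `|J|` of
  -- the `d` equations give a square system for these basis values.
  obtain ⟨J, hJ, hmax⟩ := exists_maximal_linearIndepOn F v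
  have hJli : LinearIndependent F fun l : J => v l := hJ
  have hvJ : ∀ j, v j ∈ Submodule.span F (Set.range fun l : J => v l) := by
    intro j
    have himg : (Set.range fun l : J => v l) = v '' J := by
      rw [Set.image_eq_range]
    rw [himg]
    by_cases hj : j ∈ J
    · exact Submodule.subset_span ⟨j, hj, rfl⟩
    · obtain ⟨a, ha, hav⟩ := hmax j hj
      exact (Submodule.smul_mem_iff _ ha).1 hav
  have hJcard : Fintype.card J ≤ d := by
    let w : Finset E := s.image fun a : F => D (a : E)
    have hle := linearIndependent_le_span' _ hJli (w : Set E) (by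
      rintro _ ⟨l, rfl⟩
      change D (x l) ∈ Submodule.span F (w : Set E)
      rw [Finset.coe_image]
      exact hDP ⟨x l, hxF l⟩)
    rw [Cardinal.mk_fintype, Nat.cast_le, ← Set.toFinset_card (w : Set E),
      Finset.toFinset_coe] at hle
    exact hle.trans (Finset.card_image_le.trans hcard)
  obtain ⟨ρ⟩ : Nonempty (J ↪ Fin d) := Function.Embedding.nonempty_of_card_le (by simpa using hJcard)
  choose g hg using fun j => (Submodule.mem_span_range_iff_exists_fun F).1 (hvJ j)
  have hgJ : ∀ l l' : J, g l l' = if l = l' then 1 else 0 := by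
    intro l l'
    have h0 : ∑ i, (g l i - if l = i then 1 else 0) • v i = 0 := by
      simp only [sub_smul, Finset.sum_sub_distrib, hg, ite_smul, one_smul, zero_smul,
        Finset.sum_ite_eq, Finset.mem_univ, if_true, sub_self]
    exact sub_eq_zero.1 (Fintype.linearIndependent_iff.1 hJli _ h0 l')
  let 𝓜 : Matrix J J (MvPolynomial (Fin d × Fin n) F) :=
    Matrix.of fun l' l => ∑ j, X (ρ l', j) * C (g j l)
  have h𝓜 : ∀ l' l, 𝓜 l' l = ∑ j, X (ρ l', j) * C (g j l) := fun _ _ => rfl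
  -- Setting the indeterminate at `(ρ l, l)` to `1` for every `l ∈ J` and all others to `0` turns
  -- the matrix into the identity. The determinant is thus a nonzero polynomial over `F`, and stays
  -- nonzero at the algebraically independent `c`.
  have hdet : 𝓜.det ≠ 0 := by
    let u : Fin d × Fin n → F := fun p => if ∃ l : J, ρ l = p.1 ∧ (l : Fin n) = p.2 then 1 else 0
    have hmap : (eval u).mapMatrix 𝓜 = 1 := by
      refine Matrix.ext fun l' l => ?_
      simp only [h𝓜, RingHom.mapMatrix_apply, Matrix.map_apply, map_sum, map_mul, eval_X, eval_C]
      rw [Finset.sum_eq_single (l' : Fin n)]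
      · simp only [u]
        rw [if_pos ⟨l', rfl, rfl⟩, one_mul, hgJ, Matrix.one_apply]
      · intro j _ hj
        simp only [u]
        rw [if_neg, zero_mul]
        rintro ⟨l'', h1, h2⟩
        rw [ρ.injective h1] at h2
        exact hj h2.symm
      · simp
    intro h0
    have := congrArg (eval u) h0
    rw [RingHom.map_det, hmap, Matrix.det_one, map_zero] at this
    exact one_ne_zero this
  have hdetE : ((aeval c).mapMatrix 𝓜).det ≠ 0 := by
    rw [← AlgHom.map_det]
    exact fun h0 => hdet (hc.eq_zero_of_aeval_eq_zero _ h0)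
  have hzero : (fun l : J => v l) = 0 := by
    refine Matrix.eq_zero_of_mulVec_eq_zero hdetE ?_
    funext l'
    have h1 := hD (ρ l')
    rw [Pi.zero_apply, ← h1]
    simp only [Matrix.mulVec, dotProduct, AlgHom.mapMatrix_apply, Matrix.map_apply, h𝓜, map_sum,
      map_mul, aeval_X, aeval_C, Finset.sum_mul]
    rw [Finset.sum_comm]
    refine Finset.sum_congr rfl fun j _ => ?_
    have h2 : D (x j) = _ := (hg j).symm
    rw [h2, Finset.mul_sum]
    refine Finset.sum_congr rfl fun l _ => ?_
    rw [Algebra.smul_def, mul_assoc]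
  have h3 := (hg j).symm
  change D (x j) = _ at h3
  rw [h3]
  refine Finset.sum_eq_zero fun l _ => ?_
  have := congrFun hzero l
  simp only [Pi.zero_apply] at this
  rw [this, smul_zero]

lemma isAlgebraic_adjoin_of_isIntegralElem {k A F : Type*} [Field k] [CommRing A] [Algebra k A]
    [Field F] [Algebra k F] {ι : Type*} {ℓ : ι → A} (φ : A →ₐ[k] F) {a : A}
    (ha : (aeval ℓ : MvPolynomial ι k →ₐ[k] A).toRingHom.IsIntegralElem a) :
    IsAlgebraic (Algebra.adjoin k (Set.range (φ ∘ ℓ))) (φ a) := by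
  obtain ⟨p, hp, hpa⟩ := ha
  let θ : MvPolynomial ι k →ₐ[k] Algebra.adjoin k (Set.range (φ ∘ ℓ)) :=
    aeval fun i => ⟨φ (ℓ i), Algebra.subset_adjoin ⟨i, rfl⟩⟩
  have hθ : (algebraMap (Algebra.adjoin k (Set.range (φ ∘ ℓ))) F).comp (θ : _ →+* _) =
      (φ : A →+* F).comp (aeval ℓ : MvPolynomial ι k →ₐ[k] A).toRingHom := by
    apply MvPolynomial.ringHom_ext
    · intro a
      simp [θ, ← IsScalarTower.algebraMap_apply]
    · intro i
      simp [θ]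
  have hint : IsIntegral (Algebra.adjoin k (Set.range (φ ∘ ℓ))) (φ a) := by
    refine ⟨p.map (θ : _ →+* _), hp.map _, ?_⟩
    rw [Polynomial.eval₂_map, hθ]
    have := congrArg φ hpa
    rw [map_zero] at this
    rw [← this]
    exact (Polynomial.hom_eval₂ p _ (φ : A →+* F) a).symm
  exact hint.isAlgebraic

/-- Let `x` generate a subalgebra that is integral over `d` of its elements. Then a field that is
generated by `x` and algebraic over the field of rational functions in the indeterminate
coefficients and values of `d` linear forms in `x` is separable over it. -/
theorem formallyUnramified_of_generic {k A K E : Type u} [Field k] [PerfectField k] [CommRing A]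
    [Algebra k A] [Field K] [Field E] [Algebra k K] [Algebra k E] [Algebra K E]
    [IsScalarTower k K E] [Algebra.IsAlgebraic K E] {n d : ℕ} {x : Fin n → A} {ℓ : Fin d → A}
    (hx : Algebra.adjoin k (Set.range x) = ⊤)
    (hint : ∀ a, (aeval ℓ : MvPolynomial (Fin d) k →ₐ[k] A).toRingHom.IsIntegralElem a)
    (φ : A →ₐ[k] E) {c : Fin d × Fin n → K} {t : Fin d → K}
    (hct : IsTranscendenceBasis k (Sum.elim t c))
    (ht : ∀ i, algebraMap K E (t i) = ∑ j, algebraMap K E (c (i, j)) * φ (x j))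
    (hgen : IntermediateField.adjoin K (Set.range (φ ∘ x)) = ⊤) :
    Algebra.FormallyUnramified K E := by
  set F := IntermediateField.adjoin k (Set.range (φ ∘ x)) with hF
  have hφF : ∀ a, φ a ∈ F := by
    intro a
    have ha : a ∈ Algebra.adjoin k (Set.range x) := by rw [hx]; trivial
    induction ha using Algebra.adjoin_induction with
    | mem a ha =>
      obtain ⟨j, rfl⟩ := ha
      exact IntermediateField.subset_adjoin _ _ ⟨j, rfl⟩
    | algebraMap a => rw [φ.commutes]; exact F.algebraMap_mem a
    | add a b _ _ ha hb => rw [map_add]; exact F.add_mem ha hb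
    | mul a b _ _ ha hb => rw [map_mul]; exact F.mul_mem ha hb
  let φ₀ : A →ₐ[k] F := φ.codRestrict F.toSubalgebra hφF
  have halg : Algebra.IsAlgebraic (Algebra.adjoin k (Set.range (φ₀ ∘ ℓ))) F := by
    constructor
    rintro ⟨z, hz⟩
    induction hz using IntermediateField.adjoin_induction with
    | mem z hz =>
      obtain ⟨j, rfl⟩ := hz
      exact isAlgebraic_adjoin_of_isIntegralElem φ₀ (hint (x j))
    | algebraMap a =>
      have := isAlgebraic_algebraMap (A := F)
        (algebraMap k (Algebra.adjoin k (Set.range (φ₀ ∘ ℓ))) a)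
      rwa [← IsScalarTower.algebraMap_apply] at this
    | add a b ha' hb' ha hb => exact ha.add hb
    | inv a ha' ha => exact ha.inv
    | mul a b ha' hb' ha hb => exact ha.mul hb
  have htrF : Algebra.trdeg k F ≤ d := by
    refine (Algebra.IsAlgebraic.trdeg_le_cardinalMk k (Set.range (φ₀ ∘ ℓ))).trans ?_
    have := Cardinal.mk_range_le_lift (f := φ₀ ∘ ℓ)
    simpa using this
  have hctE : IsTranscendenceBasis k (algebraMap K E ∘ Sum.elim t c) := hct.algebraMap_comp
  have htrE : Algebra.trdeg k E = ((d + d * n : ℕ) : Cardinal.{u}) := by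
    have := hctE.lift_cardinalMk_eq_trdeg
    simpa using this.symm
  -- Of the transcendence degree `d + d * n` of `E` over `k`, at most `d` is used by `F`. As `E` is
  -- algebraic over `F[c]`, the `d * n` elements `c` must be independent over `F`.
  have hle : ((d * n : ℕ) : Cardinal.{u}) ≤ Algebra.trdeg F E := by
    have hadd := trdeg_add_eq k F (A := E)
    rw [htrE] at hadd
    obtain ⟨a, ha⟩ := Cardinal.lt_aleph0.1 (htrF.trans_lt Cardinal.natCast_lt_aleph0)
    have hb' : Algebra.trdeg F E ≤ ((d + d * n : ℕ) : Cardinal.{u}) := by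
      rw [← hadd]; exact le_add_self
    obtain ⟨b, hb⟩ := Cardinal.lt_aleph0.1 (hb'.trans_lt Cardinal.natCast_lt_aleph0)
    rw [ha, hb, ← Nat.cast_add, Nat.cast_inj] at hadd
    rw [ha, Nat.cast_le] at htrF
    rw [hb, Nat.cast_le]
    omega
  have halgE : Algebra.IsAlgebraic (Algebra.adjoin F (Set.range (algebraMap K E ∘ c))) E := by
    rw [hctE.isAlgebraic_iff]
    have hcmem : ∀ p, algebraMap K E (c p) ∈ Algebra.adjoin F (Set.range (algebraMap K E ∘ c)) :=
      fun p => Algebra.subset_adjoin ⟨p, rfl⟩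
    rintro (i | p)
    · refine isAlgebraic_algebraMap (A := E)
        (⟨algebraMap K E (t i), ?_⟩ : Algebra.adjoin F (Set.range (algebraMap K E ∘ c)))
      rw [ht i]
      refine Subalgebra.sum_mem _ fun j _ => Subalgebra.mul_mem _ (hcmem _) ?_
      exact Subalgebra.algebraMap_mem _ (⟨φ (x j), hφF _⟩ : F)
    · exact isAlgebraic_algebraMap (A := E)
        (⟨algebraMap K E (c p), hcmem p⟩ : Algebra.adjoin F (Set.range (algebraMap K E ∘ c)))
  have hcF : AlgebraicIndependent F (algebraMap K E ∘ c) :=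
    (Algebra.IsAlgebraic.isTranscendenceBasis_of_lift_le_trdeg_of_finite F (algebraMap K E ∘ c)
      (by simpa using hle)).1
  have hder : ∀ D : Derivation K E E, D = 0 := by
    intro D
    have hDx : ∀ j, D (φ (x j)) = 0 := by
      intro j
      refine derivation_eq_zero_of_generic (φ ∘ x) (algebraMap K E ∘ c) hcF htrF
        (D.restrictScalars k) (fun i => ?_) j
      have h1 : D (algebraMap K E (t i)) = 0 := D.map_algebraMap _
      rw [ht i, map_sum] at h1
      rw [← h1]
      refine Finset.sum_congr rfl fun j _ => ?_
      rw [D.leibniz, D.map_algebraMap, smul_zero, add_zero]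
      rfl
    ext z
    have hz : z ∈ IntermediateField.adjoin K (Set.range (φ ∘ x)) := by rw [hgen]; trivial
    refine derivation_eq_zero_of_mem_adjoin D ?_ hz
    rintro _ ⟨j, rfl⟩
    exact hDx j
  constructor
  refine subsingleton_of_forall_eq 0 fun ω => ?_
  -- Over a field it suffices that the dual of the differentials vanishes, and this dual is the
  -- space of derivations.
  rw [← Module.forall_dual_apply_eq_zero_iff E]
  intro ψ
  have h0 : ψ = 0 := (KaehlerDifferential.linearMapEquivDerivation K E).injective
    ((hder _).trans (hder _).symm)
  rw [h0, LinearMap.zero_apply]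

end Separability

/-! ### Krull dimension of integral extensions. -/

section KrullDim

/-- Incomparability shows that chains of primes of `S` contract to chains of the same length; lying
over and going up lift chains from `R`. -/
lemma ringKrullDim_eq_of_isIntegral (R S : Type*) [CommRing R] [CommRing S] [Algebra R S]
    [Algebra.IsIntegral R S] (hinj : Function.Injective (algebraMap R S)) :
    ringKrullDim S = ringKrullDim R := by
  apply le_antisymm
  · refine Order.krullDim_le_of_strictMono (PrimeSpectrum.comap (algebraMap R S)) fun P Q h => ?_
    exact Ideal.IsIntegral.comap_lt_comap (R := R) (I := P.asIdeal) (J := Q.asIdeal) h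
  · refine iSup_le fun l => ?_
    obtain ⟨Q, -, hQ, hQP⟩ := Ideal.exists_ideal_over_prime_of_isIntegral (S := S)
      l.head.asIdeal ⊥ (by
        rw [Ideal.comap_bot_of_injective _ hinj]
        exact bot_le)
    have : Q.LiesOver l.head.asIdeal := ⟨hQP.symm⟩
    obtain ⟨m, hm, -⟩ := Ideal.exists_ltSeries_of_hasGoingUp l Q
    rw [← hm]
    exact Order.LTSeries.length_le_krullDim m

end KrullDim

/-! ### From fields to finite reduced algebras. -/

section Unramified

universe u

/-- The version of `formallyUnramified_of_generic` for finite reduced algebras. -/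
theorem formallyUnramified_of_generic_of_isReduced {k A K B : Type u} [Field k] [PerfectField k]
    [CommRing A] [Algebra k A] [Field K] [CommRing B] [IsReduced B] [Algebra k K] [Algebra k B]
    [Algebra K B] [IsScalarTower k K B] [Module.Finite K B] {n d : ℕ} {x : Fin n → A}
    {ℓ : Fin d → A} (hx : Algebra.adjoin k (Set.range x) = ⊤)
    (hint : ∀ a, (aeval ℓ : MvPolynomial (Fin d) k →ₐ[k] A).toRingHom.IsIntegralElem a)
    (φ : A →ₐ[k] B) {c : Fin d × Fin n → K} {t : Fin d → K}
    (hct : IsTranscendenceBasis k (Sum.elim t c))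
    (ht : ∀ i, algebraMap K B (t i) = ∑ j, algebraMap K B (c (i, j)) * φ (x j))
    (hgen : Algebra.adjoin K (Set.range (φ ∘ x)) = ⊤) :
    Algebra.FormallyUnramified K B := by
  -- A reduced Artinian ring is the product of its residue fields, so each factor can be treated as
  -- a field extension.
  have : IsArtinianRing B := IsArtinianRing.of_finite K B
  rw [Algebra.FormallyUnramified.iff_of_equiv ((IsArtinianRing.equivPi B).restrictScalars K),
    Algebra.FormallyUnramified.pi_iff]
  intro I
  let π : B →ₐ[K] B ⧸ I.asIdeal := Ideal.Quotient.mkₐ K I.asIdeal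
  have hπ : Function.Surjective π := Ideal.Quotient.mk_surjective
  let : Field (B ⧸ I.asIdeal) := Ideal.Quotient.field I.asIdeal
  have : Module.Finite K (B ⧸ I.asIdeal) := Module.Finite.of_surjective π.toLinearMap hπ
  refine formallyUnramified_of_generic (E := B ⧸ I.asIdeal) hx hint
    ((π.restrictScalars k).comp φ) hct (fun i => ?_) ?_
  · have := congrArg π (ht i)
    rw [π.commutes, map_sum] at this
    rw [this]
    refine Finset.sum_congr rfl fun j _ => ?_
    rw [map_mul, π.commutes]
    rfl
  · rw [eq_top_iff]
    intro z _
    obtain ⟨b, rfl⟩ := hπ z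
    have hb : π b ∈ (Algebra.adjoin K (Set.range (φ ∘ x))).map π := by
      rw [hgen]; exact ⟨b, trivial, rfl⟩
    rw [AlgHom.map_adjoin, ← Set.range_comp] at hb
    exact IntermediateField.algebra_adjoin_le_adjoin _ _ hb

end Unramified

/-! ### A frame determines the dimension. -/

section FrameFinite

variable {k A : Type*} [Field k] [CommRing A] [Algebra k A]

lemma exists_mem_affineSpan_pow {ι : Type*} {x : ι → A}
    (hx : Algebra.adjoin k (Set.range x) = ⊤) (a : A) : ∃ s, a ∈ affineSpan k x ^ s := by
  have ha : a ∈ Algebra.adjoin k (Set.range x) := by rw [hx]; trivial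
  rw [Algebra.adjoin_range_eq_range_aeval] at ha
  obtain ⟨p, rfl⟩ := ha
  exact ⟨_, aeval_mem_affineSpan_pow x p le_rfl⟩

lemma NoetherFrame.finite {V : Submodule k A} {ι κ μ : Type*} [Fintype κ] [Fintype μ] {ℓ : ι → A}
    {e : κ → A} {y : μ → A} {f : MvPolynomial ι k} (h : NoetherFrame V ℓ e y f)
    (hV : ∀ a, ∃ s, a ∈ V ^ s) : (aeval ℓ : MvPolynomial ι k →ₐ[k] A).toRingHom.Finite := by
  let : Algebra (MvPolynomial ι k) A := (aeval ℓ : MvPolynomial ι k →ₐ[k] A).toRingHom.toAlgebra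
  change Module.Finite (MvPolynomial ι k) A
  classical
  refine ⟨⟨Finset.univ.image y, ?_⟩⟩
  rw [eq_top_iff]
  intro a _
  obtain ⟨s, hs⟩ := hV a
  obtain ⟨g, -, rfl⟩ := mem_degreeComb.1 (h.generate s hs)
  rw [polyComb_apply]
  refine Submodule.sum_mem _ fun m _ => ?_
  exact Submodule.smul_mem _ (g m) (Submodule.subset_span (by simp))

lemma NoetherFrame.injective_aeval {V : Submodule k A} {ι κ μ : Type*} [Fintype κ] [Nonempty κ]
    [Fintype μ] {ℓ : ι → A} {e : κ → A} {y : μ → A} {f : MvPolynomial ι k}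
    (h : NoetherFrame V ℓ e y f) : Function.Injective (aeval ℓ : MvPolynomial ι k →ₐ[k] A) := by
  rw [injective_iff_map_eq_zero]
  intro p hp
  have h0 : polyComb k ℓ e (fun _ => p) = polyComb k ℓ e 0 := by
    simp [polyComb_apply, hp]
  exact congrFun (h.injective h0) (Classical.arbitrary κ)

lemma NoetherFrame.ringKrullDim_eq {V : Submodule k A} {κ μ : Type*} {d : ℕ} [Fintype κ]
    [Nonempty κ] [Fintype μ] {ℓ : Fin d → A} {e : κ → A} {y : μ → A} {f : MvPolynomial (Fin d) k}
    (h : NoetherFrame V ℓ e y f) (hV : ∀ a, ∃ s, a ∈ V ^ s) : ringKrullDim A = d := by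
  let : Algebra (MvPolynomial (Fin d) k) A :=
    (aeval ℓ : MvPolynomial (Fin d) k →ₐ[k] A).toRingHom.toAlgebra
  have : Module.Finite (MvPolynomial (Fin d) k) A := h.finite hV
  rw [ringKrullDim_eq_of_isIntegral (MvPolynomial (Fin d) k) A h.injective_aeval,
    MvPolynomial.ringKrullDim_of_isNoetherianRing]
  simp

end FrameFinite

/-! ### The generic fibre of the generic projection. -/

section GenericFiber

open nonZeroDivisors

lemma exists_inv_smul_algebraMap {R S : Type*} [CommRing R] [IsDomain R] [CommRing S] [Algebra R S]
    (z : Localization (Algebra.algebraMapSubmonoid S R⁰)) :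
    ∃ (r : R) (s : S), r ≠ 0 ∧ z = (algebraMap R (FractionRing R) r)⁻¹ •
      algebraMap S (Localization (Algebra.algebraMapSubmonoid S R⁰)) s := by
  obtain ⟨⟨s, ⟨_, r, hr, rfl⟩⟩, h⟩ :=
    IsLocalization.surj (Algebra.algebraMapSubmonoid S R⁰) z
  have hr0 : r ≠ 0 := nonZeroDivisors.ne_zero hr
  refine ⟨r, s, hr0, ?_⟩
  rw [← h]
  have hr' : algebraMap R (FractionRing R) r ≠ 0 := by simpa using hr0
  rw [eq_inv_smul_iff₀ hr', Algebra.smul_def, mul_comm, ← IsScalarTower.algebraMap_apply,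
    IsScalarTower.algebraMap_apply R S]

lemma finite_localization {R S κ : Type*} [CommRing R] [IsDomain R] [CommRing S] [Algebra R S]
    [Finite κ] {e : κ → S}
    (hmax : ∀ s : S, ∃ r : R, r ≠ 0 ∧ r • s ∈ Submodule.span R (Set.range e)) :
    Module.Finite (FractionRing R) (Localization (Algebra.algebraMapSubmonoid S R⁰)) := by
  let Λ := Localization (Algebra.algebraMapSubmonoid S R⁰)
  refine ⟨Submodule.fg_def.2 ⟨_, Set.finite_range (algebraMap S Λ ∘ e), ?_⟩⟩
  rw [eq_top_iff]
  intro z _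
  obtain ⟨r, s, -, rfl⟩ := exists_inv_smul_algebraMap z
  refine Submodule.smul_mem _ _ ?_
  obtain ⟨a, ha, has⟩ := hmax s
  have key : ∀ b ∈ Submodule.span R (Set.range e), algebraMap S Λ b ∈
      Submodule.span (FractionRing R) (Set.range (algebraMap S Λ ∘ e)) := by
    intro b hb
    induction hb using Submodule.span_induction with
    | mem b hb =>
      obtain ⟨i, rfl⟩ := hb
      exact Submodule.subset_span ⟨i, rfl⟩
    | zero => rw [map_zero]; exact Submodule.zero_mem _
    | add b c _ _ hb hc => rw [map_add]; exact Submodule.add_mem _ hb hc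
    | smul r b _ hb =>
      rw [Algebra.smul_def, map_mul, ← IsScalarTower.algebraMap_apply,
        IsScalarTower.algebraMap_apply R (FractionRing R), ← Algebra.smul_def]
      exact Submodule.smul_mem _ _ hb
  have h := key _ has
  rw [Algebra.smul_def, map_mul, ← IsScalarTower.algebraMap_apply,
    IsScalarTower.algebraMap_apply R (FractionRing R), ← Algebra.smul_def] at h
  exact (Submodule.smul_mem_iff _ (by simpa using ha)).1 h

lemma adjoin_localization {R S : Type*} [CommRing R] [IsDomain R] [CommRing S] [Algebra R S]
    {t : Set S} (ht : Algebra.adjoin R t = ⊤) :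
    Algebra.adjoin (FractionRing R)
      (algebraMap S (Localization (Algebra.algebraMapSubmonoid S R⁰)) '' t) = ⊤ := by
  let Λ := Localization (Algebra.algebraMapSubmonoid S R⁰)
  rw [eq_top_iff]
  rintro z -
  obtain ⟨r, s, -, rfl⟩ := exists_inv_smul_algebraMap z
  refine Subalgebra.smul_mem _ ?_ _
  have hs : s ∈ Algebra.adjoin R t := by rw [ht]; trivial
  induction hs using Algebra.adjoin_induction with
  | mem b hb => exact Algebra.subset_adjoin ⟨b, hb, rfl⟩
  | algebraMap r =>
    rw [← IsScalarTower.algebraMap_apply, IsScalarTower.algebraMap_apply R (FractionRing R)]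
    exact Subalgebra.algebraMap_mem _ _
  | add b c _ _ hb hc => rw [map_add]; exact add_mem hb hc
  | mul b c _ _ hb hc => rw [map_mul]; exact mul_mem hb hc

lemma isTranscendenceBasis_fractionRing (k σ τ : Type*) [Field k] :
    IsTranscendenceBasis k (Sum.elim
      (fun i : σ => algebraMap (MvPolynomial σ (MvPolynomial τ k)) (FractionRing (MvPolynomial σ (MvPolynomial τ k)))
        (X i))
      (fun j : τ => algebraMap (MvPolynomial σ (MvPolynomial τ k)) (FractionRing (MvPolynomial σ (MvPolynomial τ k)))
        (C (X j)))) := by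
  have h := (sumAlgEquiv k σ τ).isTranscendenceBasis (IsTranscendenceBasis.mvPolynomial (σ ⊕ τ) k)
  have : Algebra.IsAlgebraic (MvPolynomial σ (MvPolynomial τ k))
      (FractionRing (MvPolynomial σ (MvPolynomial τ k))) :=
    IsLocalization.isAlgebraic _ (nonZeroDivisors _)
  convert h.algebraMap_comp (A := FractionRing (MvPolynomial σ (MvPolynomial τ k))) using 1
  funext s
  rcases s with i | j <;> simp

universe u

/-- A general fibre of the generic linear projection of the spectrum of `A` has as many points as
a Noether frame has basis elements. -/
theorem NoetherFrame.exists_card_fiber {k A : Type u} [Field k] [IsAlgClosed k] [CommRing A]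
    [IsReduced A] [Algebra k A] {n d : ℕ} {x : Fin n → A} {κ μ : Type*} [Fintype κ] [Fintype μ]
    {ℓ : Fin d → A} {e : κ → A} {y : μ → A} {f : MvPolynomial (Fin d) k}
    (h : NoetherFrame (affineSpan k x) ℓ e y f) (hx : Algebra.adjoin k (Set.range x) = ⊤) :
    ∃ F : MvPolynomial (Fin d) (MvPolynomial (Fin d × Fin n) k), F ≠ 0 ∧
      ∀ φ : MvPolynomial (Fin d) (MvPolynomial (Fin d × Fin n) k) →+* k, φ F ≠ 0 →
      Nat.card {ψ : MvPolynomial (Fin d × Fin n) A →+* k // ψ.comp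
        (aeval (genericForm d x) : MvPolynomial (Fin d) (MvPolynomial (Fin d × Fin n) k) →ₐ[
          MvPolynomial (Fin d × Fin n) k] MvPolynomial (Fin d × Fin n) A).toRingHom = φ} =
        Fintype.card κ := by
  classical
  set R := MvPolynomial (Fin d) (MvPolynomial (Fin d × Fin n) k) with hR
  set S := MvPolynomial (Fin d × Fin n) A with hS
  have hVx := exists_mem_affineSpan_pow hx
  let θ : R →ₐ[MvPolynomial (Fin d × Fin n) k] S := aeval (genericForm d x)
  let : Algebra R S := θ.toRingHom.toAlgebra
  have hsmul : ∀ (r : R) (s : S), r • s = θ r * s := fun r s => rfl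
  have hinj : ∀ {r : ℕ} (g : Fin r → S), LinearIndependent R g →
      Function.Injective (polyComb (MvPolynomial (Fin d × Fin n) k) (genericForm d x) g) := by
    intro r g hg
    rw [injective_iff_map_eq_zero]
    intro c hc
    rw [polyComb_apply] at hc
    exact funext fun i => Fintype.linearIndependent_iff.1 hg c hc i
  have he : LinearIndependent R fun i => (C (e i) : S) := by
    rw [Fintype.linearIndependent_iff]
    intro c hc
    have := h.injective_polyComb_genericForm (a₁ := c) (a₂ := 0) (by
      rw [map_zero, polyComb_apply]; exact hc)
    exact congrFun this
  -- An element with no nonzero multiple in the span of `e` would extend `e` to an independent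
  -- family of size `|κ| + 1`, against `card_le_of_injective`.
  have hmax : ∀ s : S, ∃ r : R, r ≠ 0 ∧ r • s ∈
      Submodule.span R (Set.range fun i => (C (e i) : S)) := by
    intro s
    by_contra! hcon
    let E := Fintype.equivFin κ
    let g : Fin (Fintype.card κ + 1) → S := Fin.cons s fun i => C (e (E.symm i))
    have hg : LinearIndependent R g := by
      rw [Fintype.linearIndependent_iff]
      intro c hc
      rw [Fin.sum_univ_succ] at hc
      simp only [g, Fin.cons_zero, Fin.cons_succ] at hc
      have hc0 : c 0 = 0 := by
        by_contra h0
        refine hcon _ h0 ?_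
        rw [eq_neg_of_add_eq_zero_left hc]
        exact Submodule.neg_mem _ (Submodule.sum_mem _ fun i _ =>
          Submodule.smul_mem _ _ (Submodule.subset_span ⟨_, rfl⟩))
      rw [hc0, zero_smul, zero_add] at hc
      have := Fintype.linearIndependent_iff.1 (he.comp E.symm E.symm.injective)
        (fun i => c i.succ) hc
      intro i
      refine Fin.cases hc0 this i
    have := h.card_le_of_injective hVx g (hinj g hg)
    omega
  have hθC : ∀ p, θ (C (X p)) = X p := by
    intro p
    rw [← algebraMap_eq, θ.commutes, algebraMap_def, map_X]
  have hθk : ∀ a : k, θ (C (C a)) = C (algebraMap k A a) := by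
    intro a
    rw [← algebraMap_eq (R := MvPolynomial (Fin d × Fin n) k), θ.commutes, algebraMap_def, map_C]
  have : IsScalarTower k R S := IsScalarTower.of_algebraMap_eq fun a => (hθk a).symm
  have hadj : Algebra.adjoin R (Set.range fun j => (C (x j) : S)) = ⊤ := by
    rw [eq_top_iff]
    rintro s -
    induction s using MvPolynomial.induction_on with
    | C a =>
      have ha : a ∈ Algebra.adjoin k (Set.range x) := by rw [hx]; trivial
      induction ha using Algebra.adjoin_induction with
      | mem a ha =>
        obtain ⟨j, rfl⟩ := ha
        exact Algebra.subset_adjoin ⟨j, rfl⟩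
      | algebraMap a =>
        rw [← hθk a]
        exact Subalgebra.algebraMap_mem _ _
      | add a b _ _ ha hb => rw [C_add]; exact add_mem ha hb
      | mul a b _ _ ha hb => rw [C_mul]; exact mul_mem ha hb
    | add p q hp hq => exact add_mem hp hq
    | mul_X p i hp =>
      refine mul_mem hp ?_
      rw [← hθC i]
      exact Subalgebra.algebraMap_mem _ _
  have : Algebra.FiniteType R S :=
    ⟨⟨(Set.finite_range _).toFinset, by rw [Set.Finite.coe_toFinset]; exact hadj⟩⟩
  -- The fraction field of `R` is the rational function field in the coefficients and values of the
  -- generic forms. The localization is finite over it, and reduced since `A` is.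
  have hunr : Algebra.FormallyUnramified (FractionRing R)
      (Localization (Algebra.algebraMapSubmonoid S R⁰)) := by
    have := finite_localization hmax
    have : IsScalarTower k (FractionRing R) (Localization (Algebra.algebraMapSubmonoid S R⁰)) := by
      refine IsScalarTower.of_algebraMap_eq fun a => ?_
      rw [IsScalarTower.algebraMap_apply k R (FractionRing R), ← IsScalarTower.algebraMap_apply,
        IsScalarTower.algebraMap_apply R S, ← IsScalarTower.algebraMap_apply k R S,
        ← IsScalarTower.algebraMap_apply]
    have hKS : ∀ r : R, algebraMap (FractionRing R)
        (Localization (Algebra.algebraMapSubmonoid S R⁰)) (algebraMap R _ r) =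
        algebraMap S _ (θ r) := by
      intro r
      rw [← IsScalarTower.algebraMap_apply, IsScalarTower.algebraMap_apply R S]
      rfl
    refine formallyUnramified_of_generic_of_isReduced hx
      (fun a => (h.finite hVx).to_isIntegral a)
      ((IsScalarTower.toAlgHom k S _).comp (IsScalarTower.toAlgHom k A S))
      (isTranscendenceBasis_fractionRing k (Fin d) (Fin d × Fin n)) (fun i => ?_) ?_
    · rw [hKS]
      have : θ (X i) = genericForm d x i := aeval_X _ _
      rw [this, genericForm, map_sum]
      refine Finset.sum_congr rfl fun j _ => ?_
      rw [map_mul, ← hθC (i, j)]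
      exact congrArg (· * _) (hKS _).symm
    · have := adjoin_localization hadj
      rwa [← Set.range_comp] at this
  exact exists_card_fiber_eq he hmax (exists_smul_kaehlerDifferential_eq_zero R S (FractionRing R)
    (Localization (Algebra.algebraMapSubmonoid S R⁰)))

end GenericFiber

/-! ### Frames compute degrees. -/

section Degree

universe u

variable {k : Type u} [Field k] {n : ℕ}

/-- The coordinate ring of (the Zariski closure of) a subset of affine space. -/
abbrev CoordinateRing (Z : Set (Fin n → k)) : Type u :=
  MvPolynomial (Fin n) k ⧸ vanishingIdeal k Z

/-- The coordinate functions on a subset of affine space. -/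
noncomputable def coordinate (Z : Set (Fin n → k)) (j : Fin n) : CoordinateRing Z :=
  Ideal.Quotient.mk _ (X j)

lemma subset_zariskiClosure (Z : Set (Fin n → k)) : Z ⊆ zariskiClosure Z := by
  intro z hz
  rw [zariskiClosure, mem_zeroLocus_iff]
  exact fun p hp => mem_vanishingIdeal_iff.1 hp z hz

lemma vanishingIdeal_zariskiClosure (Z : Set (Fin n → k)) :
    vanishingIdeal k (zariskiClosure Z) = vanishingIdeal k Z := by
  apply le_antisymm
  · intro p hp
    exact mem_vanishingIdeal_iff.2 fun z hz =>
      mem_vanishingIdeal_iff.1 hp z (subset_zariskiClosure Z hz)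
  · intro p hp
    exact mem_vanishingIdeal_iff.2 fun z hz => mem_zeroLocus_iff.1 hz p hp

lemma IsAffineVariety.zariskiClosure_eq {Z : Set (Fin n → k)} (hZ : IsAffineVariety Z) :
    zariskiClosure Z = Z := by
  refine (subset_zariskiClosure Z).antisymm' ?_
  obtain ⟨I, rfl⟩ := hZ
  intro z hz
  rw [mem_zeroLocus_iff]
  intro p hp
  refine mem_zeroLocus_iff.1 hz p (mem_vanishingIdeal_iff.2 fun w hw => ?_)
  exact mem_zeroLocus_iff.1 hw p hp

instance (Z : Set (Fin n → k)) : IsReduced (CoordinateRing Z) := by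
  rw [← Ideal.isRadical_iff_quotient_reduced]
  rintro p ⟨m, hm⟩
  rw [mem_vanishingIdeal_iff] at hm ⊢
  intro z hz
  have := hm z hz
  rw [map_pow] at this
  exact eq_zero_of_pow_eq_zero this

lemma adjoin_coordinate (Z : Set (Fin n → k)) :
    Algebra.adjoin k (Set.range (coordinate Z)) = ⊤ := by
  have h : Set.range (coordinate Z) = Ideal.Quotient.mkₐ k (vanishingIdeal k Z) '' Set.range X := by
    rw [← Set.range_comp]; rfl
  rw [h, ← AlgHom.map_adjoin, adjoin_range_X, Algebra.map_top, AlgHom.range_eq_top]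
  exact Ideal.Quotient.mkₐ_surjective _ _

/-- The specialization of the indeterminate coefficients of linear forms and of their values. -/
noncomputable def specialize {d : ℕ} (c : Fin d × Fin (n + 1) → k) :
    MvPolynomial (Fin d) (MvPolynomial (Fin d × Fin n) k) →+* k :=
  -- The section is given by `∑ⱼ cᵢⱼ xⱼ = -cᵢ₀`, whence the sign of the prescribed values.
  eval₂Hom (eval fun p : Fin d × Fin n => c (p.1, p.2.succ)) fun i => -c (i, 0)

/-- Up to sign, coefficients and values of the forms are together just the free entries of `c`, so a
nonzero `F` gives a nonempty open condition on `c` as `HasDegree` requires. -/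
lemma exists_eval_eq_specialize [Infinite k] {d : ℕ}
    {F : MvPolynomial (Fin d) (MvPolynomial (Fin d × Fin n) k)} (hF : F ≠ 0) :
    ∃ P : MvPolynomial (Fin d × Fin (n + 1)) k, P ≠ 0 ∧ ∀ c, eval c P = specialize c F := by
  obtain ⟨G, rfl⟩ := (sumAlgEquiv k (Fin d) (Fin d × Fin n)).surjective F
  have hG : G ≠ 0 := by rintro rfl; simp at hF
  let P : MvPolynomial (Fin d × Fin (n + 1)) k :=
    aeval (Sum.elim (fun i => -X (i, 0)) fun p : Fin d × Fin n => X (p.1, p.2.succ)) G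
  have hP : ∀ c, eval c P =
      eval (Sum.elim (fun i => -c (i, 0)) fun p : Fin d × Fin n => c (p.1, p.2.succ)) G := by
    intro c
    have : (eval c).comp (aeval (Sum.elim (fun i => -X (i, 0))
        fun p : Fin d × Fin n => X (p.1, p.2.succ)) :
          _ →ₐ[k] MvPolynomial (Fin d × Fin (n + 1)) k).toRingHom =
        eval (Sum.elim (fun i => -c (i, 0)) fun p : Fin d × Fin n => c (p.1, p.2.succ)) := by
      apply ringHom_ext
      · intro a; simp
      · rintro (i | p) <;> simp
    exact DFunLike.congr_fun this G
  refine ⟨P, ?_, fun c => ?_⟩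
  · intro h0
    refine hG (MvPolynomial.funext fun v => ?_)
    let c : Fin d × Fin (n + 1) → k :=
      fun p => Fin.cases (-v (Sum.inl p.1)) (fun j => v (Sum.inr (p.1, j))) p.2
    have hc := hP c
    rw [h0, map_zero] at hc
    rw [map_zero, hc]
    congr 2
    funext s
    rcases s with i | p <;> simp [c]
  · rw [hP]
    have : (specialize c).comp (sumAlgEquiv k (Fin d) (Fin d × Fin n)).toRingEquiv.toRingHom =
        eval (Sum.elim (fun i => -c (i, 0)) fun p : Fin d × Fin n => c (p.1, p.2.succ)) := by
      apply ringHom_ext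
      · intro a; simp [specialize]
      · rintro (i | p) <;> simp [specialize]
    exact (DFunLike.congr_fun this G).symm

/-- The points of a linear section are the points of the fibre of the generic linear
projection. -/
lemma card_fiber_genericForm {d : ℕ} (Z : Set (Fin n → k)) (c : Fin d × Fin (n + 1) → k) :
    ENat.card {ψ : MvPolynomial (Fin d × Fin n) (CoordinateRing Z) →+* k // ψ.comp
      (aeval (genericForm d (coordinate Z)) :
        MvPolynomial (Fin d) (MvPolynomial (Fin d × Fin n) k) →ₐ[
          MvPolynomial (Fin d × Fin n) k]
          MvPolynomial (Fin d × Fin n) (CoordinateRing Z)).toRingHom = specialize c} =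
      (zariskiClosure Z ∩ linearSection d c).encard := by
  set θ : MvPolynomial (Fin d) (MvPolynomial (Fin d × Fin n) k) →ₐ[
          MvPolynomial (Fin d × Fin n) k]
          MvPolynomial (Fin d × Fin n) (CoordinateRing Z) :=
    aeval (genericForm d (coordinate Z)) with hθ
  have hθX : ∀ i, θ (X i) = ∑ j, X (i, j) * C (coordinate Z j) := fun i => aeval_X _ _
  have hθC : ∀ p, θ (C (X p)) = X p := by
    intro p
    rw [← algebraMap_eq, θ.commutes, algebraMap_def, map_X]
  have hθk : ∀ a : k, θ (C (C a)) = C (algebraMap k _ a) := by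
    intro a
    rw [← algebraMap_eq (R := MvPolynomial (Fin d × Fin n) k), θ.commutes, algebraMap_def, map_C]
  have hX : ∀ ψ : MvPolynomial (Fin d × Fin n) (CoordinateRing Z) →+* k,
      ψ.comp θ.toRingHom = specialize c → ∀ p, ψ (X p) = c (p.1, p.2.succ) := by
    intro ψ hψ p
    have := DFunLike.congr_fun hψ (C (X p))
    simpa [specialize, hθC] using this
  have hk : ∀ ψ : MvPolynomial (Fin d × Fin n) (CoordinateRing Z) →+* k,
      ψ.comp θ.toRingHom = specialize c → ∀ a, ψ (C (Ideal.Quotient.mk _ (C a))) = a := by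
    intro ψ hψ a
    have := DFunLike.congr_fun hψ (C (C a))
    have h' : ψ (C (algebraMap k (CoordinateRing Z) a)) = a := by
      simpa [specialize, hθk] using this
    exact h'
  have hmk : ∀ ψ : MvPolynomial (Fin d × Fin n) (CoordinateRing Z) →+* k,
      ψ.comp θ.toRingHom = specialize c → ∀ p, ψ (C (Ideal.Quotient.mk _ p)) =
        eval (fun j => ψ (C (coordinate Z j))) p := by
    intro ψ hψ p
    have : (ψ.comp C).comp (Ideal.Quotient.mk (vanishingIdeal k Z)) =
        eval (fun j => ψ (C (coordinate Z j))) := by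
      apply ringHom_ext
      · intro a
        simpa using hk ψ hψ a
      · intro j
        simp [coordinate]
    exact DFunLike.congr_fun this p
  rw [← ENat.card_coe_set_eq]
  refine ENat.card_congr (Equiv.ofBijective (fun ψ => ⟨fun j => ψ.1 (C (coordinate Z j)), ?_, ?_⟩)
    ⟨?_, ?_⟩)
  · rw [zariskiClosure, mem_zeroLocus_iff]
    intro p hp
    have h := hmk ψ.1 ψ.2 p
    rw [Ideal.Quotient.eq_zero_iff_mem.2 hp, map_zero, map_zero] at h
    exact h.symm
  · intro i
    have h := DFunLike.congr_fun ψ.2 (X i)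
    simp only [RingHom.comp_apply, AlgHom.toRingHom_eq_coe, RingHom.coe_coe, hθX, map_sum, map_mul,
      hX ψ.1 ψ.2] at h
    rw [h]
    simp [specialize]
  · intro ψ ψ' h
    have h' : ∀ j, ψ.1 (C (coordinate Z j)) = ψ'.1 (C (coordinate Z j)) := fun j =>
      congrFun (congrArg Subtype.val h) j
    refine Subtype.ext (ringHom_ext (fun a => ?_) fun p => ?_)
    · obtain ⟨p, rfl⟩ := Ideal.Quotient.mk_surjective a
      rw [hmk _ ψ.2, hmk _ ψ'.2]
      simp only [h']
    · rw [hX _ ψ.2, hX _ ψ'.2]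
  · rintro ⟨z, hz, hzc⟩
    let ev : CoordinateRing Z →+* k := Ideal.Quotient.lift _ (eval z) fun p hp =>
      mem_zeroLocus_iff.1 hz p hp
    have hevX : ∀ j, ev (coordinate Z j) = z j := fun j =>
      (Ideal.Quotient.lift_mk _ _ _).trans (eval_X j)
    have hevk : ∀ a : k, ev (algebraMap k _ a) = a := fun a =>
      (Ideal.Quotient.lift_mk _ _ _).trans (eval_C a)
    clear_value ev
    refine ⟨⟨eval₂Hom ev fun p => c (p.1, p.2.succ), ?_⟩, Subtype.ext (funext fun j => ?_)⟩
    · apply ringHom_ext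
      · intro q
        induction q using MvPolynomial.induction_on with
        | C a => simp [hθk, specialize, hevk]
        | add p q hp hq => simp only [map_add, hp, hq]
        | mul_X p i hp =>
          simp only [map_mul, hp]
          congr 1
          simp [hθC, specialize]
      · intro i
        have := hzc i
        simp only [RingHom.comp_apply, AlgHom.toRingHom_eq_coe, RingHom.coe_coe, hθX, map_sum, map_mul,
          coe_eval₂Hom, eval₂_X, eval₂_C, hevX, specialize]
        linear_combination this
    · simp [hevX]

theorem NoetherFrame.hasDegree [IsAlgClosed k] {Z : Set (Fin n → k)} {d : ℕ} {κ μ : Type*}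
    [Fintype κ] [Nonempty κ] [Fintype μ] {ℓ : Fin d → CoordinateRing Z} {e : κ → CoordinateRing Z}
    {y : μ → CoordinateRing Z} {f : MvPolynomial (Fin d) k}
    (h : NoetherFrame (affineSpan k (coordinate Z)) ℓ e y f) :
    HasDegree (zariskiClosure Z) (Fintype.card κ) := by
  have : Infinite k := IsAlgClosed.instInfinite
  obtain ⟨F, hF, hcard⟩ := h.exists_card_fiber (adjoin_coordinate Z)
  obtain ⟨P, hP, hPF⟩ := exists_eval_eq_specialize hF
  refine ⟨d, ?_, P, hP, fun c hc => ?_⟩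
  · rw [dimension, vanishingIdeal_zariskiClosure]
    exact h.ringKrullDim_eq (exists_mem_affineSpan_pow (adjoin_coordinate Z))
  · rw [← card_fiber_genericForm]
    rw [hPF] at hc
    have h1 := hcard _ hc
    -- An infinite fibre would have `Nat.card` equal to `0`; since `κ` is nonempty, the count rules
    -- this out.
    have : Finite {ψ : MvPolynomial (Fin d × Fin n) (CoordinateRing Z) →+* k // ψ.comp
      (aeval (genericForm d (coordinate Z)) :
        MvPolynomial (Fin d) (MvPolynomial (Fin d × Fin n) k) →ₐ[
          MvPolynomial (Fin d × Fin n) k]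
          MvPolynomial (Fin d × Fin n) (CoordinateRing Z)).toRingHom = specialize c} :=
      Nat.finite_of_card_ne_zero (by rw [h1]; exact Fintype.card_ne_zero)
    rw [ENat.card_eq_coe_natCard, h1]

end Degree

/-! ### Complementary linear subspaces and affine subspaces. -/

section Projective

variable {k : Type*} [Field k] {n : ℕ}

lemma eval_smul_of_isHomogeneous {σ : Type*} {F : MvPolynomial σ k} {m : ℕ}
    (hF : F.IsHomogeneous m) (a : k) (v : σ → k) : eval (a • v) F = a ^ m * eval v F := by
  rw [eval_eq, eval_eq, Finset.mul_sum]
  refine Finset.sum_congr rfl fun γ hγ => ?_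
  have hm : γ.degree = m := by
    rw [Finsupp.degree_eq_weight_one]
    exact hF (mem_support_iff.1 hγ)
  simp only [Pi.smul_apply, smul_eq_mul, mul_pow, Finset.prod_mul_distrib]
  rw [Finset.prod_pow_eq_pow_sum, ← hm, Finsupp.degree_apply]
  ring

lemma cons_one_ne_zero (x : Fin n → k) : (Fin.cons 1 x : Fin (n + 1) → k) ≠ 0 := fun h =>
  one_ne_zero (congrFun h 0)

/-- A linear subspace is cut out by linear forms, which are homogeneous polynomials of degree `1`
and so are among those defining the closure. -/
lemma projectiveClosure_subset_iff {Z : Set (Fin n → k)}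
    {L : Projectivization.Subspace k (Fin (n + 1) → k)} :
    projectiveClosure Z ⊆ (L : Set (ℙ k (Fin (n + 1) → k))) ↔
      ∀ x ∈ Z, (Fin.cons 1 x : Fin (n + 1) → k) ∈ L.submodule := by
  classical
  constructor
  · intro h x hx
    rw [Projectivization.Subspace.mem_submodule_iff _ (cons_one_ne_zero x)]
    refine h fun m F hF hFZ => ?_
    obtain ⟨a, ha⟩ := Projectivization.exists_smul_eq_mk_rep k _ (cons_one_ne_zero x)
    rw [← ha, Units.smul_def, eval_smul_of_isHomogeneous hF, hFZ x hx, mul_zero]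
  · intro h p hp
    suffices hr : p.rep ∈ L.submodule by
      rw [Projectivization.Subspace.mem_submodule_iff _ p.rep_nonzero, p.mk_rep] at hr
      exact hr
    by_contra hr
    obtain ⟨f, hf, hfL⟩ := Submodule.exists_le_ker_of_notMem hr
    let F : MvPolynomial (Fin (n + 1)) k := ∑ i, C (f fun j => if i = j then 1 else 0) * X i
    have hF : ∀ v, eval v F = f v := by
      intro v
      rw [LinearMap.pi_apply_eq_sum_univ f v]
      simp [F, mul_comm]
    refine hf ?_
    rw [← hF]
    refine hp 1 F ?_ fun x hx => ?_
    · exact IsHomogeneous.sum _ _ _ fun i _ => isHomogeneous_C_mul_X _ _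
    · rw [hF]
      exact hfL (h x hx)

lemma inComplementarySubspaces_iff {X Y : Set (Fin n → k)} :
    InComplementarySubspaces X Y ↔ ∃ U W : Submodule k (Fin (n + 1) → k), IsCompl U W ∧
      (∀ x ∈ X, Fin.cons 1 x ∈ U) ∧ ∀ y ∈ Y, Fin.cons 1 y ∈ W := by
  constructor
  · rintro ⟨L, M, h, hX, hY⟩
    exact ⟨L.submodule, M.submodule, Projectivization.Subspace.submodule.isCompl h,
      projectiveClosure_subset_iff.1 hX, projectiveClosure_subset_iff.1 hY⟩
  · rintro ⟨U, W, h, hX, hY⟩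
    refine ⟨U.projectivization, W.projectivization, Submodule.projectivization.isCompl h,
      projectiveClosure_subset_iff.2 ?_, projectiveClosure_subset_iff.2 ?_⟩
    · simpa using hX
    · simpa using hY

/-- The affine subspace `{x | (1, x) ∈ U}`. -/
def affineSlice (U : Submodule k (Fin (n + 1) → k)) : AffineSubspace k (Fin n → k) where
  carrier := {x | Fin.cons 1 x ∈ U}
  smul_vsub_vadd_mem' c p q r hp hq hr := by
    have h : (Fin.cons 1 (c • (p -ᵥ q) +ᵥ r) : Fin (n + 1) → k) =
        c • (Fin.cons 1 p - Fin.cons 1 q) + Fin.cons 1 r := by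
      funext i
      refine Fin.cases ?_ (fun j => ?_) i <;> simp
    change Fin.cons 1 _ ∈ U
    rw [h]
    exact U.add_mem (U.smul_mem _ (U.sub_mem hp hq)) hr

lemma cons_zero_mem_of_mem_direction {U : Submodule k (Fin (n + 1) → k)}
    (hU : (affineSlice U : Set (Fin n → k)).Nonempty) {v : Fin n → k}
    (hv : v ∈ (affineSlice U).direction) : (Fin.cons 0 v : Fin (n + 1) → k) ∈ U := by
  obtain ⟨p, hp, q, hq, rfl⟩ := (AffineSubspace.mem_direction_iff_eq_vsub hU v).1 hv
  have h : (Fin.cons 0 (p -ᵥ q) : Fin (n + 1) → k) = Fin.cons 1 p - Fin.cons 1 q := by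
    funext i
    refine Fin.cases ?_ (fun j => ?_) i <;> simp
  rw [h]
  exact U.sub_mem hp hq

/-- The vector space spanned by `(1, a)` for `a` in an affine subspace through `a₀`. -/
def coneOver (A : AffineSubspace k (Fin n → k)) (a₀ : Fin n → k) :
    Submodule k (Fin (n + 1) → k) where
  carrier := {z | ∃ t : k, ∃ w ∈ A.direction, z = Fin.cons t (t • a₀ + w)}
  zero_mem' := ⟨0, 0, zero_mem _, by
    funext i
    refine Fin.cases ?_ (fun j => ?_) i <;> simp⟩
  add_mem' := by
    rintro _ _ ⟨t, w, hw, rfl⟩ ⟨s, v, hv, rfl⟩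
    refine ⟨t + s, w + v, add_mem hw hv, ?_⟩
    funext i
    refine Fin.cases ?_ (fun j => ?_) i
    · simp
    · simp only [Pi.add_apply, Fin.cons_succ, Pi.smul_apply, smul_eq_mul]
      ring
  smul_mem' := by
    rintro c _ ⟨t, w, hw, rfl⟩
    refine ⟨c * t, c • w, A.direction.smul_mem c hw, ?_⟩
    funext i
    refine Fin.cases ?_ (fun j => ?_) i
    · simp
    · simp only [Pi.add_apply, Fin.cons_succ, Pi.smul_apply, smul_eq_mul]
      ring

lemma cons_one_mem_coneOver {A : AffineSubspace k (Fin n → k)} {a₀ x : Fin n → k} (ha : a₀ ∈ A)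
    (hx : x ∈ A) : (Fin.cons 1 x : Fin (n + 1) → k) ∈ coneOver A a₀ :=
  ⟨1, x - a₀, AffineSubspace.vsub_mem_direction hx ha, by simp⟩

/-- A common vector with first coordinate `t ≠ 0` would rescale to a common point of `A` and `B`;
one with `t = 0` is a common direction. -/
lemma disjoint_coneOver {A B : AffineSubspace k (Fin n → k)} {a₀ b₀ : Fin n → k} (ha : a₀ ∈ A)
    (hb : b₀ ∈ B) (hAB : Disjoint (A : Set (Fin n → k)) (B : Set (Fin n → k)))
    (hdir : Disjoint A.direction B.direction) : Disjoint (coneOver A a₀) (coneOver B b₀) := by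
  rw [Submodule.disjoint_def]
  rintro _ ⟨t, w, hw, rfl⟩ ⟨s, v, hv, h⟩
  obtain ⟨rfl, h⟩ := Fin.cons_inj.1 h
  by_cases ht : t = 0
  · subst ht
    simp only [zero_smul, zero_add] at h ⊢
    subst h
    rw [Submodule.disjoint_def.1 hdir w hw hv]
    funext i
    refine Fin.cases ?_ (fun j => ?_) i <;> simp
  · exfalso
    have h1 : t⁻¹ • w +ᵥ a₀ ∈ A :=
      AffineSubspace.vadd_mem_of_mem_direction (A.direction.smul_mem _ hw) ha
    have h2 : t⁻¹ • v +ᵥ b₀ ∈ B :=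
      AffineSubspace.vadd_mem_of_mem_direction (B.direction.smul_mem _ hv) hb
    have h3 : t⁻¹ • w +ᵥ a₀ = t⁻¹ • v +ᵥ b₀ := by
      have := congrArg (t⁻¹ • ·) h
      simp only [smul_add, smul_smul, inv_mul_cancel₀ ht, one_smul] at this
      rw [vadd_eq_add, vadd_eq_add, add_comm, this, add_comm]
    rw [← h3] at h2
    exact Set.disjoint_left.1 hAB h1 h2

/-- The projective closures lie in complementary linear subspaces if and only if the sets lie in
disjoint affine subspaces without common directions. -/
theorem inComplementarySubspaces_iff_inDisjointNonparallelSubspaces {X Y : Set (Fin n → k)}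
    (hX : X.Nonempty) (hY : Y.Nonempty) :
    InComplementarySubspaces X Y ↔ InDisjointNonparallelSubspaces X Y := by
  rw [inComplementarySubspaces_iff]
  constructor
  · rintro ⟨U, W, h, hXU, hYW⟩
    have h0 := Submodule.disjoint_def.1 h.disjoint
    refine ⟨affineSlice U, affineSlice W, Set.disjoint_left.2 fun x hx hx' =>
      cons_one_ne_zero x (h0 _ hx hx'), Submodule.disjoint_def.2 fun v hv hv' => ?_, hXU, hYW⟩
    have := h0 _ (cons_zero_mem_of_mem_direction (hX.mono hXU) hv)
      (cons_zero_mem_of_mem_direction (hY.mono hYW) hv')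
    funext j
    exact congrFun this j.succ
  · rintro ⟨A, B, hAB, hdir, hXA, hYB⟩
    obtain ⟨a₀, ha⟩ := hX
    obtain ⟨b₀, hb⟩ := hY
    -- Disjoint cones need not span; enlarging the first one makes them complementary.
    obtain ⟨U, hU, hUW⟩ := (disjoint_coneOver (hXA ha) (hYB hb) hAB hdir).exists_isCompl
    exact ⟨U, _, hUW, fun x hx => hU (cons_one_mem_coneOver (hXA ha) (hXA hx)),
      fun y hy => cons_one_mem_coneOver (hYB hb) (hYB hy)⟩

end Projective

/-! ### Minkowski sums as images of products. -/

section Product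

universe u

variable {k : Type u} [Field k] {n : ℕ}

/-- The pullback of functions on `Z` along a map to `Z`. -/
noncomputable def pullback {T : Type*} (Z : Set (Fin n → k)) (g : T → Fin n → k)
    (hg : ∀ t, g t ∈ Z) : CoordinateRing Z →ₐ[k] (T → k) :=
  Ideal.Quotient.liftₐ _ (AlgHom.pi fun t => aeval (g t)) fun p hp => by
    funext t
    exact mem_vanishingIdeal_iff.1 hp _ (hg t)

lemma pullback_mk {T : Type*} {Z : Set (Fin n → k)} {g : T → Fin n → k} (hg : ∀ t, g t ∈ Z)
    (p : MvPolynomial (Fin n) k) (t : T) :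
    pullback Z g hg (Ideal.Quotient.mk _ p) t = aeval (g t) p := rfl

lemma pullback_coordinate {T : Type*} {Z : Set (Fin n → k)} {g : T → Fin n → k}
    (hg : ∀ t, g t ∈ Z) (j : Fin n) : pullback Z g hg (coordinate Z j) = fun t => g t j := by
  funext t
  rw [coordinate, pullback_mk, aeval_X]

lemma pullback_injective {T : Type*} {Z : Set (Fin n → k)} {g : T → Fin n → k}
    (hg : ∀ t, g t ∈ Z) (hZ : ∀ z ∈ Z, ∃ t, g t = z) :
    Function.Injective (pullback Z g hg) := by
  rw [injective_iff_map_eq_zero]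
  intro a ha
  obtain ⟨p, rfl⟩ := Ideal.Quotient.mk_surjective a
  rw [Ideal.Quotient.eq_zero_iff_mem, mem_vanishingIdeal_iff]
  intro z hz
  obtain ⟨t, rfl⟩ := hZ z hz
  rw [← pullback_mk hg, ha]
  rfl

lemma map_affineSpan {A B ι : Type*} [CommRing A] [Algebra k A] [CommRing B] [Algebra k B]
    (φ : A →ₐ[k] B) (x : ι → A) :
    (affineSpan k x).map φ.toLinearMap = affineSpan k (φ ∘ x) := by
  rw [affineSpan, affineSpan, Submodule.map_span, Set.image_insert_eq, ← Set.range_comp]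
  simp

/-- Products of independent functions in separate variables are independent. -/
lemma linearIndependent_mul_prod {S T P Q : Type*} {a : P → S → k} {b : Q → T → k}
    (ha : LinearIndependent k a) (hb : LinearIndependent k b) :
    LinearIndependent k fun (p : P × Q) (s : S × T) => a p.1 s.1 * b p.2 s.2 := by
  classical
  rw [linearIndependent_iff'] at ha hb ⊢
  intro s c hc
  let c' : P × Q → k := fun p => if p ∈ s then c p else 0
  have hsub : s ⊆ s.image Prod.fst ×ˢ s.image Prod.snd := Finset.subset_product
  have h1 : ∀ σ τ, ∑ q ∈ s.image Prod.snd, (∑ p ∈ s.image Prod.fst, c' (p, q) * a p σ) * b q τ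
      = 0 := by
    intro σ τ
    have h := congrFun hc (σ, τ)
    simp only [Finset.sum_apply, Pi.smul_apply, smul_eq_mul, Pi.zero_apply] at h
    rw [← h]
    have h2 : ∑ p ∈ s, c p * (a p.1 σ * b p.2 τ) = ∑ p ∈ s, c' p * (a p.1 σ * b p.2 τ) :=
      Finset.sum_congr rfl fun p hp => by simp only [c', if_pos hp]
    rw [h2, Finset.sum_subset hsub fun p _ hp => by simp only [c', if_neg hp, zero_mul],
      Finset.sum_product_right]
    refine Finset.sum_congr rfl fun q _ => ?_
    rw [Finset.sum_mul]
    exact Finset.sum_congr rfl fun p _ => by ring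
  have h2 : ∀ σ, ∀ q ∈ s.image Prod.snd, ∑ p ∈ s.image Prod.fst, c' (p, q) * a p σ = 0 := by
    intro σ
    refine hb _ _ (funext fun τ => ?_)
    simpa [Finset.sum_apply] using h1 σ τ
  rintro ⟨p, q⟩ hpq
  have h3 := ha (s.image Prod.fst) (fun p => c' (p, q)) (funext fun σ => by
    simpa [Finset.sum_apply] using h2 σ q (Finset.mem_image_of_mem _ hpq)) p
    (Finset.mem_image_of_mem _ hpq)
  simpa only [c', if_pos hpq] using h3

lemma pullback_comp {S T : Type*} {Z : Set (Fin n → k)} {g : T → Fin n → k} (hg : ∀ t, g t ∈ Z)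
    (h : S → T) (a : CoordinateRing Z) (s : S) :
    pullback Z (fun s => g (h s)) (fun s => hg (h s)) a s = pullback Z g hg a (h s) := by
  obtain ⟨p, rfl⟩ := Ideal.Quotient.mk_surjective a
  rfl

/-- This expresses that the tensor product of the coordinate rings embeds into the functions on `X ×
Y`, as `NoetherFrame.prod` requires. -/
lemma linearIndependent_pullback_mul {X Y : Set (Fin n → k)} {P Q : Type*}
    {a : P → CoordinateRing X} {b : Q → CoordinateRing Y} (ha : LinearIndependent k a)
    (hb : LinearIndependent k b) :
    LinearIndependent k fun p : P × Q =>
      pullback X (fun s : X × Y => s.1.1) (fun s => s.1.2) (a p.1) *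
        pullback Y (fun s : X × Y => s.2.1) (fun s => s.2.2) (b p.2) := by
  have ha' : LinearIndependent k fun p => pullback X (fun x : X => x.1) (fun x => x.2) (a p) :=
    ha.map' (pullback X (fun x : X => x.1) fun x => x.2).toLinearMap
      (LinearMap.ker_eq_bot.2 (pullback_injective (fun x : X => x.2)
        fun z hz => ⟨⟨z, hz⟩, rfl⟩))
  have hb' : LinearIndependent k fun q => pullback Y (fun y : Y => y.1) (fun y => y.2) (b q) :=
    hb.map' (pullback Y (fun y : Y => y.1) fun y => y.2).toLinearMap
      (LinearMap.ker_eq_bot.2 (pullback_injective (fun y : Y => y.2)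
        fun z hz => ⟨⟨z, hz⟩, rfl⟩))
  have h := linearIndependent_mul_prod ha' hb'
  simp only [← pullback_comp (fun x : X => x.2) (Prod.fst : X × Y → X),
    ← pullback_comp (fun y : Y => y.2) (Prod.snd : X × Y → Y)] at h
  exact h

/-- A linear form with prescribed restriction to a subspace that vanishes on a disjoint one. -/
lemma exists_linearForm {V : Type*} [AddCommGroup V] [Module k V] {U W : Submodule k V}
    (h : Disjoint U W) (f : V →ₗ[k] k) :
    ∃ g : V →ₗ[k] k, (∀ u ∈ U, g u = f u) ∧ ∀ w ∈ W, g w = 0 := by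
  obtain ⟨W', hW, hUW⟩ := h.symm.exists_isCompl
  refine ⟨LinearMap.ofIsCompl hUW 0 (f ∘ₗ U.subtype), fun u hu => ?_, fun w hw => ?_⟩
  · exact LinearMap.ofIsCompl_apply_right hUW ⟨u, hu⟩
  · exact LinearMap.ofIsCompl_apply_left hUW ⟨w, hW hw⟩

lemma linearForm_comp_mem_affineSpan {T : Type*} (g : T → Fin n → k) (f : (Fin n → k) →ₗ[k] k)
    (a : k) : (fun t => f (g t) + a) ∈ affineSpan k fun j t => g t j := by
  have h : (fun t => f (g t) + a) =
      ∑ j, (f fun i => if j = i then 1 else 0) • (fun t => g t j) + a • (1 : T → k) := by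
    funext t
    rw [LinearMap.pi_apply_eq_sum_univ f (g t)]
    simp [mul_comm]
  rw [h]
  exact Submodule.add_mem _ (Submodule.sum_mem _ fun j _ =>
    Submodule.smul_mem _ _ (mem_affineSpan (fun j t => g t j) j))
    (Submodule.smul_mem _ _ (one_mem_affineSpan _))

/-- If `X` and `Y` lie in affine subspaces without common directions, then affine linear functions
of `α x + y` are the sums of affine linear functions of `x` and of `y`. -/
lemma affineSpan_smul_add {X Y : Set (Fin n → k)} {A B : AffineSubspace k (Fin n → k)}
    (hdir : Disjoint A.direction B.direction) (hXA : X ⊆ (A : Set (Fin n → k)))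
    (hYB : Y ⊆ (B : Set (Fin n → k))) (hX : X.Nonempty) (hY : Y.Nonempty) {α : k} (hα : α ≠ 0) :
    affineSpan k (fun j (p : X × Y) => (α • p.1.1 + p.2.1) j) =
      affineSpan k (fun j (p : X × Y) => p.1.1 j) ⊔ affineSpan k (fun j (p : X × Y) => p.2.1 j) := by
  obtain ⟨x₀, hx₀⟩ := hX
  obtain ⟨y₀, hy₀⟩ := hY
  apply le_antisymm
  · refine affineSpan_le (Submodule.mem_sup_left (one_mem_affineSpan _)) fun j => ?_
    refine Submodule.add_mem _ (Submodule.mem_sup_left (Submodule.smul_mem _ α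
      (mem_affineSpan (fun j (p : X × Y) => p.1.1 j) j))) (Submodule.mem_sup_right
        (mem_affineSpan (fun j (p : X × Y) => p.2.1 j) j))
  · refine sup_le (affineSpan_le (one_mem_affineSpan _) fun j => ?_)
      (affineSpan_le (one_mem_affineSpan _) fun j => ?_)
    -- The form `f` equals `α⁻¹` times the `j`-th coordinate on the direction of `A` and kills that
    -- of `B`. So `f (α x + y)` is `x j` up to a constant, determined at `(x₀, y₀)`.
    · obtain ⟨f, hfA, hfB⟩ := exists_linearForm hdir (α⁻¹ • LinearMap.proj (R := k) j)
      convert linearForm_comp_mem_affineSpan (fun p : X × Y => α • p.1.1 + p.2.1) f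
        (x₀ j - α * f x₀ - f y₀) using 1
      funext p
      have h1 := hfA _ (AffineSubspace.vsub_mem_direction (hXA p.1.2) (hXA hx₀))
      have h2 := hfB _ (AffineSubspace.vsub_mem_direction (hYB p.2.2) (hYB hy₀))
      simp only [vsub_eq_sub, map_sub, LinearMap.smul_apply, LinearMap.proj_apply, smul_eq_mul]
        at h1 h2
      rw [map_add, map_smul, smul_eq_mul]
      have h3 : α * α⁻¹ = 1 := mul_inv_cancel₀ hα
      linear_combination (-α) * h1 - h2 - (p.1.1 j - x₀ j) * h3
    · obtain ⟨f, hfB, hfA⟩ := exists_linearForm hdir.symm (LinearMap.proj (R := k) j)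
      convert linearForm_comp_mem_affineSpan (fun p : X × Y => α • p.1.1 + p.2.1) f
        (y₀ j - α * f x₀ - f y₀) using 1
      funext p
      have h1 := hfA _ (AffineSubspace.vsub_mem_direction (hXA p.1.2) (hXA hx₀))
      have h2 := hfB _ (AffineSubspace.vsub_mem_direction (hYB p.2.2) (hYB hy₀))
      simp only [vsub_eq_sub, map_sub, LinearMap.proj_apply] at h1 h2
      rw [map_add, map_smul, smul_eq_mul]
      linear_combination (-α) * h1 - h2

lemma nontrivial_coordinateRing {Z : Set (Fin n → k)} (hZ : Z.Nonempty) :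
    Nontrivial (CoordinateRing Z) := by
  obtain ⟨z, hz⟩ := hZ
  rw [Ideal.Quotient.nontrivial_iff, Ne, Ideal.eq_top_iff_one, mem_vanishingIdeal_iff]
  intro h
  exact one_ne_zero ((map_one _).symm.trans (h z hz))

/-- The degree of `α X + Y` is the product of the degrees of `X` and `Y`, if these lie in affine
subspaces without common directions. -/
theorem exists_hasDegree_smul_add [IsAlgClosed k] {X Y : Set (Fin n → k)}
    {A B : AffineSubspace k (Fin n → k)} (hdir : Disjoint A.direction B.direction)
    (hXA : X ⊆ (A : Set (Fin n → k))) (hYB : Y ⊆ (B : Set (Fin n → k)))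
    (hX : X.Nonempty) (hY : Y.Nonempty) :
    ∃ a b : ℕ, HasDegree (zariskiClosure X) a ∧ HasDegree (zariskiClosure Y) b ∧
      ∀ α : k, α ≠ 0 → HasDegree (zariskiClosure (α • X + Y)) (a * b) := by
  have : Infinite k := IsAlgClosed.instInfinite
  have := nontrivial_coordinateRing hX
  have := nontrivial_coordinateRing hY
  obtain ⟨d, δ, M, ℓ, e, y, f, hδ, h⟩ := exists_noetherFrame (k := k) (coordinate X)
  obtain ⟨d', δ', M', ℓ', e', y', f', hδ', h'⟩ := exists_noetherFrame (k := k) (coordinate Y)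
  have : Nonempty (Fin δ) := ⟨⟨0, hδ⟩⟩
  have : Nonempty (Fin δ') := ⟨⟨0, hδ'⟩⟩
  refine ⟨Fintype.card (Fin δ), Fintype.card (Fin δ'), h.hasDegree, h'.hasDegree, fun α hα => ?_⟩
  -- All three coordinate rings are compared inside the functions on `X × Y`. The product frame
  -- belongs to the image of the filtration of `α X + Y`, and descends along the injective map `χ`.
  let φ : CoordinateRing X →ₐ[k] (X × Y → k) := pullback X (fun p => p.1.1) fun p => p.1.2
  let ψ : CoordinateRing Y →ₐ[k] (X × Y → k) := pullback Y (fun p => p.2.1) fun p => p.2.2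
  let χ : CoordinateRing (α • X + Y) →ₐ[k] (X × Y → k) :=
    pullback (α • X + Y) (fun p => α • p.1.1 + p.2.1) fun p =>
      Set.add_mem_add (Set.smul_mem_smul_set p.1.2) p.2.2
  have hχ : Function.Injective χ := by
    refine pullback_injective _ ?_
    rintro _ ⟨_, ⟨x, hx, rfl⟩, y, hy, rfl⟩
    exact ⟨(⟨x, hx⟩, ⟨y, hy⟩), rfl⟩
  have hpr := h.prod φ ψ h' fun _ _ => linearIndependent_pullback_mul
  have hV : (affineSpan k (coordinate X)).map φ.toLinearMap ⊔
      (affineSpan k (coordinate Y)).map ψ.toLinearMap =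
        (affineSpan k (coordinate (α • X + Y))).map χ.toLinearMap := by
    rw [map_affineSpan, map_affineSpan, map_affineSpan]
    have h1 : φ ∘ coordinate X = fun j p => p.1.1 j := funext fun j => pullback_coordinate _ j
    have h2 : ψ ∘ coordinate Y = fun j p => p.2.1 j := funext fun j => pullback_coordinate _ j
    have h3 : χ ∘ coordinate (α • X + Y) = fun j p => (α • p.1.1 + p.2.1) j :=
      funext fun j => pullback_coordinate _ j
    rw [h1, h2, h3]
    exact (affineSpan_smul_add hdir hXA hYB hX hY hα).symm
  rw [hV] at hpr
  obtain ⟨ℓ₁, e₁, y₁, h₁⟩ := NoetherFrame.of_map hχ hpr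
  have := (h₁.reindex_param finSumFinEquiv).hasDegree
  rwa [Fintype.card_prod] at this

end Product

end MinkowskiDegree

/-! ### The corollary. -/

theorem corollary3p12 {𝕜 : Type*} [Field 𝕜] [IsAlgClosed 𝕜] (hchar : ringChar 𝕜 ≠ 2) {n : ℕ}
    (X Y : Set (Fin n → 𝕜))
    (hX : MinkowskiDegree.IsAffineVariety X) (hY : MinkowskiDegree.IsAffineVariety Y)
    (hX0 : X.Nonempty) (hY0 : Y.Nonempty) :
    (MinkowskiDegree.InComplementarySubspaces X Y ↔
      MinkowskiDegree.InDisjointNonparallelSubspaces X Y) ∧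
    (MinkowskiDegree.InComplementarySubspaces X Y →
      ∃ a b : ℕ, MinkowskiDegree.HasDegree X a ∧ MinkowskiDegree.HasDegree Y b ∧
        {α : 𝕜ˣ | ¬ MinkowskiDegree.HasDegree
          (MinkowskiDegree.minkowskiSum (α • X) Y) (a * b)}.Finite) := by
  have hiff := MinkowskiDegree.inComplementarySubspaces_iff_inDisjointNonparallelSubspaces hX0 hY0
  refine ⟨hiff, fun h => ?_⟩
  obtain ⟨A, B, -, hdir, hXA, hYB⟩ := hiff.1 h
  obtain ⟨a, b, ha, hb, hab⟩ :=
    MinkowskiDegree.exists_hasDegree_smul_add hdir hXA hYB hX0 hY0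
  rw [hX.zariskiClosure_eq] at ha
  rw [hY.zariskiClosure_eq] at hb
  refine ⟨a, b, ha, hb, ?_⟩
  -- The formula holds for every unit `α`, so the exceptional set is empty.
  convert Set.finite_empty
  rw [Set.eq_empty_iff_forall_notMem]
  exact fun α hα => hα (hab α α.ne_zero)
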